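/- Let $P$ be a simple $3$-dimensional convex polytope with $2n$ vertices (simple: each vertex lies on exactly three facets), whose facets are colored with the colors $1,2,3$ so that facets sharing an edge have different colors, and let $m_i$ be the number of facets of color $i$. For a facet $f$ let $\xi_f\in\{0,1\}^{V(P)}\subset\mathbb R^{2n}$ be its incidence vector, $\xi_f(v)=1$ if $v\in f$ and $\xi_f(v)=0$ otherwise. Put $S=\{\xi_f : f \text{ a facet of } P\}$, $V_i=\{\xi_f : f\text{ has color } i\}$ and $\widetilde P=\operatorname{conv}(S)$. Suppose $m_3=m_2>m_1\ge 2$. Then the $\xi_f$ are pairwise distinct, the vertex set of $\widetilde P$ is $S$, and up to the reflection $x\mapsto -x$ the Gale diagram of $\widetilde P$ (the rows of a matrix whose columns form a basis of the space of affine dependencies of the vertices, with the nonzero rows normalized to length one) lies in $\mathbb R^1$ and has exactly $m_1$ points at $0$, those of $V_1$; $m_2$ points at $1$, those of $V_2$; and $m_3$ points at $-1$, those of $V_3$. Moreover: (1) for $J\subsetneq S$, $\operatorname{conv}(J)$ is a proper face of $\widetilde P$ (a face other than $\widetilde P$; the empty face is allowed) if and only if either $V_2\not\subseteq J$ and $V_3\not\subseteq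 J$, or $V_2\cup V_3\subseteq J$; (2) $\widetilde P$ is not simplicial, i.e. not all of its proper faces are simplexes; (3) $\widetilde P$ is an $n$-polytope and an $m_1$-fold pyramid (obtained by $m_1$ times taking the convex hull with a point outside the affine hull) over a $(2m_2-2)$-dimensional polytope $K$ with $2m_2$ vertices, where $K$ is combinatorially equivalent to the cyclic polytope $C(2m_2,2m_2-2)$ (the convex hull of any $2m_2$ distinct points on the moment curve in $\mathbb R^{2m_2-2}$), and $K$ is the convex hull of a $(2m_2-2)$-simplex $\Delta$ and a point of its affine hull that is beyond exactly $m_2-1$ facets of $\Delta$ (strictly separated from $\Delta$ by the hyperplane of the facet) and beneath the other $m_2$ (strictly on the same side as $\Delta$). -/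

import Mathlib

namespace ThreeColor

section Polytopes

variable {E : Type*} [AddCommGroup E] [Module ℝ E] [TopologicalSpace E]
variable {E' : Type*} [AddCommGroup E'] [Module ℝ E'] [TopologicalSpace E']

/-- `P` is a (nonempty) convex polytope of dimension `d`: the convex hull of a finite set,
whose affine hull has dimension `d`. -/
def IsPolytopeOfDim (P : Set E) (d : ℕ) : Prop :=
  (∃ s : Finset E, P = convexHull ℝ (s : Set E)) ∧ P.Nonempty ∧
    Module.finrank ℝ (vectorSpan ℝ P) = d

/-- `F` is a face of the polytope `P`. `IsExposed ℝ P F` says that `F` is empty or the set of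
maximizers on `P` of a linear functional; so `∅` and `P` itself are faces. -/
abbrev IsFace (P F : Set E) : Prop := IsExposed ℝ P F

/-- `F` is a proper face: a face other than `P` itself (the empty face is allowed). -/
def IsProperFace (P F : Set E) : Prop := IsFace P F ∧ F ≠ P

/-- `F` is a nonempty face of `P` of dimension `k`. -/
def IsFaceOfDim (P F : Set E) (k : ℕ) : Prop :=
  IsFace P F ∧ F.Nonempty ∧ Module.finrank ℝ (vectorSpan ℝ F) = k

/-- `F` is a facet of `P`: a nonempty face of codimension one. -/
def IsFacet (P F : Set E) : Prop :=
  IsFace P F ∧ F.Nonempty ∧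
    Module.finrank ℝ (vectorSpan ℝ F) + 1 = Module.finrank ℝ (vectorSpan ℝ P)

/-- The type of facets of `P`. -/
def Facet (P : Set E) : Type _ := {F : Set E // IsFacet P F}

/-- The type of vertices of `P`. -/
abbrev Vertex (P : Set E) : Type _ := ↥(Set.extremePoints ℝ P)

/-- A simplex (of any dimension): the convex hull of a finite affinely independent set. -/
def IsSimplex (F : Set E) : Prop :=
  ∃ s : Finset E, AffineIndependent ℝ ((↑) : s → E) ∧ F = convexHull ℝ (s : Set E)

/-- A polytope is simplicial if all its proper faces are simplexes. -/
def IsSimplicial (P : Set E) : Prop := ∀ F : Set E, IsProperFace P F → IsSimplex F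

/-- Combinatorial equivalence: an inclusion-preserving bijection, with inclusion-preserving
inverse, between the sets of faces. -/
def CombEquiv (P : Set E) (Q : Set E') : Prop :=
  Nonempty ({F : Set E // IsFace P F} ≃o {G : Set E' // IsFace Q G})

/-- `IsFoldPyramid K k Q`: `Q` is a `k`-fold pyramid with basis `K`, that is, obtained from `K` by
`k` times taking the convex hull with a point outside the affine hull. -/
def IsFoldPyramid (K : Set E) : ℕ → Set E → Prop
  | 0, Q => Q = K
  | k + 1, Q => ∃ (Q' : Set E) (A : E), IsFoldPyramid K k Q' ∧ A ∉ affineSpan ℝ Q' ∧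
      Q = convexHull ℝ (insert A Q')

/-- The point `v` is beyond the face `F` of `Q` (for a facet `F` and `v` in the affine hull of `Q`:
strictly separated from `Q` by the hyperplane spanned by `F`). -/
def IsBeyond (Q F : Set E) (v : E) : Prop :=
  ∃ (l : E →L[ℝ] ℝ) (a : ℝ), (∀ x ∈ Q, l x ≤ a) ∧ F = {x ∈ Q | l x = a} ∧ a < l v

/-- The point `v` is beneath the face `F` of `Q` (for a facet `F` and `v` in the affine hull
of `Q`: strictly on the same side as `Q` of the hyperplane spanned by `F`). -/
def IsBeneath (Q F : Set E) (v : E) : Prop :=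
  ∃ (l : E →L[ℝ] ℝ) (a : ℝ), (∀ x ∈ Q, l x ≤ a) ∧ F = {x ∈ Q | l x = a} ∧ l v < a

/-- `K` is a polytope of type `T_k^d`: the convex hull of a `d`-simplex `Δ` and a point of the affine
hull of `Δ` which is beyond exactly `k` facets of `Δ` and beneath the remaining `d + 1 - k`. -/
def IsTPolytope (d k : ℕ) (K : Set E) : Prop :=
  ∃ (Δ : Set E) (v : E), IsSimplex Δ ∧ IsPolytopeOfDim Δ d ∧ v ∈ affineSpan ℝ Δ ∧ v ∉ Δ ∧
    K = convexHull ℝ (insert v Δ) ∧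
    {F : Set E | IsFacet Δ F ∧ IsBeyond Δ F v}.ncard = k ∧
    {F : Set E | IsFacet Δ F ∧ IsBeneath Δ F v}.ncard + k = d + 1

end Polytopes

/-- The cyclic polytope in `ℝ^d` with the `N` vertices `(t_i, t_i ^ 2, …, t_i ^ d)` on the moment
curve, for given distinct parameters `t_i`. -/
def cyclicPolytope (d : ℕ) {N : ℕ} (t : Fin N → ℝ) : Set (Fin d → ℝ) :=
  convexHull ℝ (Set.range fun i : Fin N => fun j : Fin d => t i ^ ((j : ℕ) + 1))

section Gale

variable {E : Type*} [AddCommGroup E] [Module ℝ E] {ι : Type*}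

/-- The null space of the matrix with columns `(1, v i)`: the affine dependencies of `v`. -/
noncomputable def affineDependencies (v : ι → E) : Submodule ℝ (ι →₀ ℝ) :=
  LinearMap.ker (Finsupp.linearCombination ℝ fun i => ((1 : ℝ), v i))

/-- `g` is a Gale transform of the finite family `v`: for some basis `b` of the space of affine
dependencies, `g i` is the `i`-th row of the matrix whose columns are the basis vectors. -/
def IsGaleTransform (v : ι → E) {k : ℕ} (g : ι → EuclideanSpace ℝ (Fin k)) : Prop :=
  ∃ b : Module.Basis (Fin k) ℝ (affineDependencies v),
    ∀ i j, g i j = (b j : ι →₀ ℝ) i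

/-- `g` is a Gale diagram of `v`: it arises from a Gale transform by normalizing the nonzero vectors
to length one (the zero vectors stay zero, since `0⁻¹ = 0`). -/
def IsGaleDiagram (v : ι → E) {k : ℕ} (g : ι → EuclideanSpace ℝ (Fin k)) : Prop :=
  ∃ g' : ι → EuclideanSpace ℝ (Fin k), IsGaleTransform v g' ∧ ∀ i, g i = ‖g' i‖⁻¹ • g' i

end Gale

section Coloring

variable {E : Type*} [AddCommGroup E] [Module ℝ E] [TopologicalSpace E]

/-- A `3`-dimensional polytope all of whose vertices lie on exactly three facets. -/
def IsSimpleThreePolytope (P : Set E) : Prop :=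
  IsPolytopeOfDim P 3 ∧ ∀ v ∈ Set.extremePoints ℝ P, {F : Set E | IsFacet P F ∧ v ∈ F}.ncard = 3

/-- A proper coloring of the facets of the `3`-polytope `P` by three colors: distinct facets that
share an edge have different colors. -/
def IsThreeColoring (P : Set E) (c : Facet P → Fin 3) : Prop :=
  ∀ f g : Facet P, f ≠ g → (∃ e : Set E, IsFaceOfDim P e 1 ∧ e ⊆ f.1 ∧ e ⊆ g.1) → c f ≠ c g

/-- The face-vertex incidence vector `ξ_f` of the facet `f`. -/
noncomputable def incVec (P : Set E) (f : Facet P) : Vertex P → ℝ :=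
  fun v => Set.indicator f.1 (fun _ => (1 : ℝ)) v.1

/-- The convex hull of all face-vertex incidence vectors of `P`. -/
noncomputable def tilde (P : Set E) : Set (Vertex P → ℝ) := convexHull ℝ (Set.range (incVec P))

/-- The set of the incidence vectors of the facets of color `i`. -/
def colorClass (P : Set E) (c : Facet P → Fin 3) (i : Fin 3) : Set (Vertex P → ℝ) :=
  incVec P '' {f | c f = i}

/-- The number of facets of color `i`. -/
noncomputable def numColor (P : Set E) (c : Facet P → Fin 3) (i : Fin 3) : ℕ :=
  {f | c f = i}.ncard

end Coloring

end ThreeColor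

open ThreeColor

/-! Each vertex of `P` lies on exactly one facet of each color (`IsThreeColoring.exists_figure`). So
the coefficients `0, 1, -1` on the colors `0, 1, 2` give a linear relation among the incidence
vectors, and an affine one because the last two classes have equal size. It spans all affine
dependencies (`hasDependency_incVec`): moving along edges that ascend for a generic functional shows
that the coefficients of any linear relation depend only on the color
(`VertexFigures.exists_eq_comp_color`), and `m₁ ≠ m₂` then kills the coefficient of color `0`.

Everything else is read off from the signs of this one dependency `lam`. A function on the points
extends to an affine function iff it is orthogonal to `lam`; hence the faces are the hulls of those
`J` outside of which `lam` has both signs or vanishes (`HasDependency.isExposed_iff`). Points with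
`lam = 0` are apexes of pyramids (`HasDependency.isFoldPyramid`). The remaining points span `K`: any
one of them has barycentric coordinates in the others given by ratios of `lam`, whose signs say
which facets it is beyond (`HasDependency.isTPolytope`). The dependency of `2m` points on the moment
curve in dimension `2m - 2` alternates in sign, so it has as many positive entries as that of `K`,
and the face lattices agree (`HasDependency.combEquiv_cyclicPolytope`).

The dimension is the number of facets minus two, which is `n` by Euler's relation
(`VertexFigures.two_mul_card_facet`). The local structure of `P` rests on the fact that a polytope
is cut out by its facets (`exists_isFacet_isBeyond`), which makes the three facet functionals at a
vertex a coordinate system (`exists_neighbors`). -/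

namespace ThreeColor

open Set Filter Topology

/-! ### Convex hulls of finite families and their exposed faces -/

section Families

variable {E : Type*} [AddCommGroup E] [Module ℝ E] {ι : Type*} [Fintype ι]

theorem mem_convexHull_range_iff (p : ι → E) (x : E) :
    x ∈ convexHull ℝ (range p) ↔
      ∃ w : ι → ℝ, (∀ i, 0 ≤ w i) ∧ ∑ i, w i = 1 ∧ ∑ i, w i • p i = x := by
  classical
  have h : range p = Fintype.linearCombination ℝ p '' range (fun i => Pi.single i (1 : ℝ)) := by
    rw [← range_comp]
    congr 1
    ext i
    simp
  rw [h, ← LinearMap.image_convexHull, convexHull_rangle_single_eq_stdSimplex]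
  simp only [mem_image, stdSimplex, mem_ofPred_eq, Fintype.linearCombination_apply, and_assoc]

omit [Module ℝ E] in
theorem sum_subtype_of_support_subset (J : Set ι) [Fintype J] (f : ι → E)
    (h : ∀ i, i ∉ J → f i = 0) : ∑ i : J, f i = ∑ i, f i := by
  classical
  rw [← Finset.sum_subset J.toFinset.subset_univ (by simpa using h),
    Finset.sum_subtype (p := (· ∈ J)) _ (by simp)]

theorem mem_convexHull_image_iff (p : ι → E) (J : Set ι) (x : E) :
    x ∈ convexHull ℝ (p '' J) ↔
      ∃ w : ι → ℝ, (∀ i, 0 ≤ w i) ∧ (∀ i, i ∉ J → w i = 0) ∧ ∑ i, w i = 1 ∧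
        ∑ i, w i • p i = x := by
  classical
  rw [image_eq_range, mem_convexHull_range_iff]
  constructor
  · rintro ⟨w, h0, h1, h2⟩
    refine ⟨fun i => if h : i ∈ J then w ⟨i, h⟩ else 0, ?_, ?_, ?_, ?_⟩
    · intro i
      dsimp only
      split_ifs
      exacts [h0 _, le_rfl]
    · intro i hi
      simp [hi]
    · rw [← h1, ← sum_subtype_of_support_subset J _ (fun i hi => by simp [hi])]
      exact Finset.sum_congr rfl fun i _ => by simp
    · rw [← h2, ← sum_subtype_of_support_subset J _ (fun i hi => by simp [hi])]
      exact Finset.sum_congr rfl fun i _ => by simp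
  · rintro ⟨w, h0, h1, h2, h3⟩
    refine ⟨fun i => w i, fun i => h0 _, ?_, ?_⟩
    · rw [← h2, sum_subtype_of_support_subset J w h1]
    · rw [← h3, ← sum_subtype_of_support_subset J _ (fun i hi => by simp [h1 i hi])]

/-- An average of numbers at most `a` equals `a` only if all the weight sits on numbers equal to
`a`. -/
theorem sep_convexHull_range (p : ι → E) (l : E →ₗ[ℝ] ℝ) (a : ℝ) (h : ∀ i, l (p i) ≤ a) :
    {x ∈ convexHull ℝ (range p) | l x = a} = convexHull ℝ (p '' {i | l (p i) = a}) := by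
  ext x
  simp only [mem_ofPred_eq, mem_convexHull_range_iff, mem_convexHull_image_iff]
  constructor
  · rintro ⟨⟨w, h0, h1, rfl⟩, h2⟩
    refine ⟨w, h0, ?_, h1, rfl⟩
    have h3 : ∑ i, w i * (a - l (p i)) = 0 := by
      simp only [map_sum, map_smul, smul_eq_mul] at h2
      simp only [mul_sub, Finset.sum_sub_distrib, h2, ← Finset.sum_mul, h1]
      ring
    rw [Finset.sum_eq_zero_iff_of_nonneg
      (fun i _ => mul_nonneg (h0 i) (sub_nonneg.2 (h i)))] at h3
    intro i hi
    rcases mul_eq_zero.1 (h3 i (Finset.mem_univ i)) with h4 | h4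
    · exact h4
    · exact absurd (sub_eq_zero.1 h4).symm hi
  · rintro ⟨w, h0, h1, h2, rfl⟩
    refine ⟨⟨w, h0, h2, rfl⟩, ?_⟩
    simp only [map_sum, map_smul, smul_eq_mul]
    have h3 : ∀ i, w i * l (p i) = w i * a := by
      intro i
      by_cases hi : l (p i) = a
      · rw [hi]
      · rw [h1 i hi]; simp
    simp only [h3, ← Finset.sum_mul, h2, one_mul]

omit [Fintype ι] in
theorem le_of_mem_convexHull_range {p : ι → E} {l : E →ₗ[ℝ] ℝ} {a : ℝ} (h : ∀ i, l (p i) ≤ a)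
    {x : E} (hx : x ∈ convexHull ℝ (range p)) : l x ≤ a := by
  have : convexHull ℝ (range p) ⊆ {x | l x ≤ a} :=
    convexHull_min (range_subset_iff.2 h) (convex_halfSpace_le l.isLinear a)
  exact this hx

variable [TopologicalSpace E]

theorem isExposed_convexHull_range_iff (p : ι → E) (F : Set E) :
    IsExposed ℝ (convexHull ℝ (range p)) F ↔ F = ∅ ∨ ∃ (l : E →L[ℝ] ℝ) (a : ℝ),
      (∀ i, l (p i) ≤ a) ∧ (∃ i, l (p i) = a) ∧ F = convexHull ℝ (p '' {i | l (p i) = a}) := by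
  constructor
  · intro h
    rcases F.eq_empty_or_nonempty with hF | hF
    · exact Or.inl hF
    · right
      obtain ⟨l, rfl⟩ := h hF
      obtain ⟨y, hy, hy'⟩ := hF
      have hle : ∀ i, l (p i) ≤ l y := fun i => hy' _ (subset_convexHull _ _ (mem_range_self i))
      have key := sep_convexHull_range p l.toLinearMap (l y) hle
      have h1 : {x ∈ convexHull ℝ (range p) | ∀ z ∈ convexHull ℝ (range p), l z ≤ l x} =
          convexHull ℝ (p '' {i | l (p i) = l y}) := by
        refine Eq.trans ?_ key
        ext x
        constructor
        · rintro ⟨h1, h2⟩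
          exact ⟨h1, le_antisymm (hy' _ h1) (h2 _ hy)⟩
        · rintro ⟨h1, h2⟩
          refine ⟨h1, fun z hz => (hy' z hz).trans h2.ge⟩
      refine ⟨l, l y, hle, ?_, h1⟩
      have : (convexHull ℝ (p '' {i | l (p i) = l y})).Nonempty := h1 ▸ ⟨y, hy, hy'⟩
      rw [convexHull_nonempty_iff, image_nonempty] at this
      exact this
  · rintro (rfl | ⟨l, a, h1, ⟨i, hi⟩, rfl⟩)
    · exact isExposed_empty
    · intro _
      refine ⟨l, ?_⟩
      have key := sep_convexHull_range p l.toLinearMap a h1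
      refine key.symm.trans ?_
      ext x
      constructor
      · rintro ⟨h2, h3⟩
        refine ⟨h2, fun z hz => ?_⟩
        have : l z ≤ a := le_of_mem_convexHull_range (l := l.toLinearMap) h1 hz
        exact this.trans h3.ge
      · rintro ⟨h2, h3⟩
        refine ⟨h2, le_antisymm (le_of_mem_convexHull_range (l := l.toLinearMap) h1 h2) ?_⟩
        have := h3 _ (subset_convexHull _ _ (mem_range_self i))
        rw [hi] at this
        exact this

end Families

/-! ### Families with at most one affine dependency: faces from signs -/

section Dependencies

variable {E : Type*} [NormedAddCommGroup E] [NormedSpace ℝ E]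
  {ι : Type*} [Fintype ι] {p : ι → E} {lam : ι → ℝ}

/-- The affine dependencies of the finite family `p` are exactly the multiples of `lam`. -/
def HasDependency (p : ι → E) (lam : ι → ℝ) : Prop :=
  ∀ μ : ι → ℝ, (∑ i, μ i = 0 ∧ ∑ i, μ i • p i = 0) ↔ ∃ t : ℝ, μ = t • lam

/-- Outside of `J`, the vector `lam` has entries of both signs, or vanishes. -/
def Balanced (lam : ι → ℝ) (J : Set ι) : Prop :=
  (∃ i, i ∉ J ∧ 0 < lam i) ↔ (∃ i, i ∉ J ∧ lam i < 0)

theorem HasDependency.sum_eq_zero (hp : HasDependency p lam) : ∑ i, lam i = 0 :=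
  ((hp lam).2 ⟨1, (one_smul _ _).symm⟩).1

theorem HasDependency.sum_smul_eq_zero (hp : HasDependency p lam) : ∑ i, lam i • p i = 0 :=
  ((hp lam).2 ⟨1, (one_smul _ _).symm⟩).2

/-- Makes simplexes the case `lam = 0` of the theory, in which every index set is balanced. -/
theorem hasDependency_zero_iff :
    HasDependency p (0 : ι → ℝ) ↔ AffineIndependent ℝ p := by
  rw [affineIndependent_iff]
  constructor
  · intro h s w h1 h2 i hi
    classical
    obtain ⟨t, ht⟩ := (h (fun i => if i ∈ s then w i else 0)).1
      ⟨by simpa using h1, by simpa [ite_smul] using h2⟩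
    have := congrFun ht i
    simpa [hi] using this
  · intro h μ
    constructor
    · rintro ⟨h1, h2⟩
      exact ⟨0, funext fun i => by simpa using h Finset.univ μ h1 h2 i (Finset.mem_univ i)⟩
    · rintro ⟨t, rfl⟩
      simp

theorem HasDependency.subtype (hp : HasDependency p lam) (T : Set ι) [Fintype T]
    (hT : ∀ i, i ∉ T → lam i = 0) :
    HasDependency (fun i : T => p i) (fun i : T => lam i) := by
  classical
  intro μ
  have key := hp (fun i => if h : i ∈ T then μ ⟨i, h⟩ else 0)
  rw [← sum_subtype_of_support_subset T _ (fun i hi => by simp [hi]),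
    ← sum_subtype_of_support_subset T _ (fun i hi => by simp [hi])] at key
  simp only [Subtype.coe_prop, dite_true, Subtype.coe_eta] at key
  rw [key]
  constructor
  · rintro ⟨t, ht⟩
    refine ⟨t, funext fun i => ?_⟩
    have := congrFun ht i
    simpa using this
  · rintro ⟨t, rfl⟩
    refine ⟨t, funext fun i => ?_⟩
    by_cases h : i ∈ T
    · simp [h]
    · simp [h, hT i h]

/-- A dependency supported in `T` is a multiple of `lam` that vanishes at an index where `lam` does
not, so the multiple is zero. -/
theorem HasDependency.affineIndependent_subtype (hp : HasDependency p lam) (T : Set ι)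
    (hT : ∃ i, i ∉ T ∧ lam i ≠ 0) : AffineIndependent ℝ (fun i : T => p i) := by
  classical
  rw [← hasDependency_zero_iff]
  intro μ
  have key := hp (fun i => if h : i ∈ T then μ ⟨i, h⟩ else 0)
  rw [← sum_subtype_of_support_subset T _ (fun i hi => by simp [hi]),
    ← sum_subtype_of_support_subset T _ (fun i hi => by simp [hi])] at key
  simp only [Subtype.coe_prop, dite_true, Subtype.coe_eta] at key
  rw [key]
  obtain ⟨j, hj, hj'⟩ := hT
  constructor
  · rintro ⟨t, ht⟩
    have h0 : t = 0 := by
      have := congrFun ht j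
      simpa [hj, hj'] using this
    subst h0
    refine ⟨0, funext fun i => ?_⟩
    have := congrFun ht i
    simpa using this
  · rintro ⟨t, rfl⟩
    exact ⟨0, funext fun i => by simp⟩

theorem finrank_vectorSpan_convexHull (s : Set E) :
    Module.finrank ℝ (vectorSpan ℝ (convexHull ℝ s)) = Module.finrank ℝ (vectorSpan ℝ s) := by
  rw [← direction_affineSpan, affineSpan_convexHull, direction_affineSpan]

theorem HasDependency.eq_sum_compl [DecidableEq ι] (hp : HasDependency p lam) {i₀ : ι}
    (h : lam i₀ ≠ 0) : ∑ i : ({i₀}ᶜ : Set ι), (-(lam i / lam i₀)) = 1 ∧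
      ∑ i : ({i₀}ᶜ : Set ι), (-(lam i / lam i₀)) • p i = p i₀ := by
  have h1 := hp.sum_eq_zero
  have h2 := hp.sum_smul_eq_zero
  have e1 : ∑ i : ({i₀}ᶜ : Set ι), lam i = -lam i₀ := by
    have := Fintype.sum_eq_add_sum_subtype_ne lam i₀
    rw [h1] at this
    exact eq_neg_of_add_eq_zero_right this.symm
  have e2 : ∑ i : ({i₀}ᶜ : Set ι), lam i • p i = -(lam i₀ • p i₀) := by
    have := Fintype.sum_eq_add_sum_subtype_ne (fun i => lam i • p i) i₀
    rw [h2] at this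
    exact eq_neg_of_add_eq_zero_right this.symm
  constructor
  · rw [Finset.sum_neg_distrib, ← Finset.sum_div, e1]
    field_simp
  · have : ∀ i : ({i₀}ᶜ : Set ι), (-(lam i / lam i₀)) • p i = (-(lam i₀)⁻¹) • (lam i • p i) := by
      intro i
      rw [smul_smul]
      congr 1
      field_simp
    simp only [this]
    rw [← Finset.smul_sum, e2, smul_neg, neg_smul, neg_neg, inv_smul_smul₀ h]

theorem HasDependency.mem_affineSpan_compl (hp : HasDependency p lam) {i₀ : ι}
    (h : lam i₀ ≠ 0) : p i₀ ∈ affineSpan ℝ (p '' {i₀}ᶜ) := by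
  classical
  obtain ⟨h1, h2⟩ := hp.eq_sum_compl h
  rw [image_eq_range, ← h2, ← Finset.affineCombination_eq_linear_combination _ _ _ h1]
  exact affineCombination_mem_affineSpan h1 _

/-- Dropping a point with nonzero coefficient keeps the affine span and leaves an affinely
independent family. -/
theorem HasDependency.finrank_vectorSpan (hp : HasDependency p lam) (h : ∃ i, lam i ≠ 0) :
    Module.finrank ℝ (vectorSpan ℝ (convexHull ℝ (range p))) + 2 = Fintype.card ι := by
  classical
  obtain ⟨i₀, hi₀⟩ := h
  have hspan : affineSpan ℝ (range p) = affineSpan ℝ (p '' {i₀}ᶜ) := by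
    apply le_antisymm
    · rw [affineSpan_le]
      rintro _ ⟨i, rfl⟩
      by_cases hi : i = i₀
      · rw [hi]
        exact hp.mem_affineSpan_compl hi₀
      · exact subset_affineSpan _ _ (mem_image_of_mem _ hi)
    · exact affineSpan_mono _ (image_subset_range _ _)
  have hind := hp.affineIndependent_subtype {i₀}ᶜ ⟨i₀, by simp, hi₀⟩
  have hcard : Fintype.card ({i₀}ᶜ : Set ι) + 1 = Fintype.card ι := by
    rw [Fintype.card_compl_set]
    simp only [Fintype.card_unique]
    have : 0 < Fintype.card ι := Fintype.card_pos_iff.2 ⟨i₀⟩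
    omega
  have hpos : 0 < Fintype.card ({i₀}ᶜ : Set ι) := by
    by_contra h0
    have : Fintype.card ι = 1 := by omega
    obtain ⟨x, hx⟩ := Fintype.card_eq_one_iff.1 this
    have h1 := hp.sum_eq_zero
    rw [Finset.sum_eq_single i₀ (fun b _ hb => absurd ((hx b).trans (hx i₀).symm) hb)
      (by simp)] at h1
    exact hi₀ h1
  rw [finrank_vectorSpan_convexHull, ← direction_affineSpan, hspan, direction_affineSpan,
    image_eq_range, hind.finrank_vectorSpan (n := Fintype.card ({i₀}ᶜ : Set ι) - 1) (by omega)]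
  omega

variable [FiniteDimensional ℝ E]

/-- Gale duality: the value vectors of affine functions on the points form the annihilator of the
dependencies. Here `h` is the slack below the level `a`. -/
theorem HasDependency.exists_functional (hp : HasDependency p lam) (h : ι → ℝ)
    (hh : ∑ i, lam i * h i = 0) : ∃ (l : E →L[ℝ] ℝ) (a : ℝ), ∀ i, l (p i) = a - h i := by
  let T : (ι → ℝ) →ₗ[ℝ] ℝ × E := Fintype.linearCombination ℝ (fun i => ((1 : ℝ), p i))
  have hT : ∀ μ, T μ = (∑ i, μ i, ∑ i, μ i • p i) := by
    intro μ
    simp only [T, Fintype.linearCombination_apply]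
    ext
    · simp [Prod.fst_sum]
    · simp [Prod.snd_sum]
  let f : Module.Dual ℝ (ι → ℝ) := Fintype.linearCombination ℝ h
  have hf : f ∈ LinearMap.range T.dualMap := by
    rw [LinearMap.range_dualMap_eq_dualAnnihilator_ker, Submodule.mem_dualAnnihilator]
    intro μ hμ
    rw [LinearMap.mem_ker, hT, Prod.mk_eq_zero] at hμ
    obtain ⟨t, rfl⟩ := (hp μ).1 hμ
    simp only [f, Fintype.linearCombination_apply, Pi.smul_apply, smul_eq_mul, mul_assoc,
      ← Finset.mul_sum, hh, mul_zero]
  obtain ⟨ψ, hψ⟩ := hf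
  classical
  refine ⟨LinearMap.toContinuousLinearMap (-(ψ ∘ₗ LinearMap.inr ℝ ℝ E)), ψ (1, 0), fun i => ?_⟩
  have h1 := LinearMap.congr_fun hψ (Pi.single i 1)
  simp only [LinearMap.dualMap_apply, f, T, Fintype.linearCombination_apply_single, one_smul,
    smul_eq_mul, one_mul] at h1
  have h2 : ((1 : ℝ), p i) = (1, 0) + (0, p i) := by simp
  rw [h2, map_add] at h1
  simp only [LinearMap.coe_toContinuousLinearMap', LinearMap.neg_apply, LinearMap.comp_apply,
    LinearMap.inr_apply]
  linarith

-- The slacks `a - l (p i)` are orthogonal to `lam`, zero on the contact set and positive off it;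
-- entries of only one sign off the contact set would make the pairing nonzero.
omit [FiniteDimensional ℝ E] in
theorem HasDependency.balanced_of_le (hp : HasDependency p lam) (l : E →L[ℝ] ℝ) (a : ℝ)
    (hl : ∀ i, l (p i) ≤ a) : Balanced lam {i | l (p i) = a} := by
  have h0 : ∑ i, lam i * (a - l (p i)) = 0 := by
    have := congrArg l hp.sum_smul_eq_zero
    simp only [map_sum, map_smul, smul_eq_mul, map_zero] at this
    simp only [mul_sub, Finset.sum_sub_distrib, this, ← Finset.sum_mul, hp.sum_eq_zero]
    simp
  have hpos : ∀ i, i ∉ {i | l (p i) = a} → 0 < a - l (p i) := fun i hi =>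
    sub_pos.2 (lt_of_le_of_ne (hl i) hi)
  have hzero : ∀ i, i ∈ {i | l (p i) = a} → a - l (p i) = 0 := fun i hi =>
    sub_eq_zero.2 (Eq.symm hi)
  constructor
  · rintro ⟨i, hi, hi'⟩
    by_contra! hcon
    refine absurd h0 (ne_of_gt (Finset.sum_pos' (fun j _ => ?_) ⟨i, Finset.mem_univ _,
      mul_pos hi' (hpos i hi)⟩))
    by_cases hj : j ∈ {i | l (p i) = a}
    · rw [hzero j hj]; simp
    · exact mul_nonneg (hcon j hj) (hpos j hj).le
  · rintro ⟨i, hi, hi'⟩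
    by_contra! hcon
    refine absurd h0 (ne_of_lt (Finset.sum_neg' (fun j _ => ?_) ⟨i, Finset.mem_univ _,
      mul_neg_of_neg_of_pos hi' (hpos i hi)⟩))
    by_cases hj : j ∈ {i | l (p i) = a}
    · rw [hzero j hj]; simp
    · exact mul_nonpos_of_nonpos_of_nonneg (hcon j hj) (hpos j hj).le

theorem HasDependency.exists_exposing (hp : HasDependency p lam) {J : Set ι}
    (hJ : Balanced lam J) : ∃ (l : E →L[ℝ] ℝ) (a : ℝ), (∀ i, l (p i) ≤ a) ∧
      {i | l (p i) = a} = J := by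
  classical
  suffices ∃ h : ι → ℝ, (∀ i, i ∈ J → h i = 0) ∧ (∀ i, i ∉ J → 0 < h i) ∧
      ∑ i, lam i * h i = 0 by
    obtain ⟨h, h1, h2, h3⟩ := this
    obtain ⟨l, a, hl⟩ := hp.exists_functional h h3
    refine ⟨l, a, fun i => ?_, ?_⟩
    · rw [hl]
      by_cases hi : i ∈ J
      · rw [h1 i hi]; simp
      · linarith [h2 i hi]
    · ext i
      simp only [mem_ofPred_eq, hl]
      by_cases hi : i ∈ J
      · simp [h1 i hi, hi]
      · have := h2 i hi
        simp only [hi, iff_false]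
        intro h'
        linarith
  by_cases hcase : ∃ i, i ∉ J ∧ 0 < lam i
  · have hcase' := hJ.1 hcase
    -- `A` and `B` are the totals of the positive and negative entries off `J`. Slack `-B` on the
    -- former and `A` on the latter makes the two contributions cancel.
    let A : ℝ := ∑ i, if i ∉ J ∧ 0 < lam i then lam i else 0
    let B : ℝ := ∑ i, if i ∉ J ∧ lam i < 0 then lam i else 0
    have hA : 0 < A := by
      obtain ⟨i, hi⟩ := hcase
      refine Finset.sum_pos' (fun j _ => ?_) ⟨i, Finset.mem_univ _, ?_⟩
      · split_ifs with h
        exacts [h.2.le, le_rfl]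
      · rw [if_pos hi]; exact hi.2
    have hB : B < 0 := by
      obtain ⟨i, hi⟩ := hcase'
      refine Finset.sum_neg' (fun j _ => ?_) ⟨i, Finset.mem_univ _, ?_⟩
      · split_ifs with h
        exacts [h.2.le, le_rfl]
      · rw [if_pos hi]; exact hi.2
    refine ⟨fun i => if i ∈ J then 0 else if 0 < lam i then -B else if lam i < 0 then A else 1,
      fun i hi => by simp [hi], fun i hi => ?_, ?_⟩
    · simp only [hi, if_false]
      split_ifs
      · linarith
      · exact hA
      · exact one_pos
    · have : ∀ i, lam i * (if i ∈ J then 0 else if 0 < lam i then -B else if lam i < 0 then A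
          else 1) = (if i ∉ J ∧ 0 < lam i then lam i else 0) * (-B) +
          (if i ∉ J ∧ lam i < 0 then lam i else 0) * A := by
        intro i
        by_cases hi : i ∈ J
        · simp [hi]
        · rcases lt_trichotomy (lam i) 0 with h | h | h
          · simp [hi, h, h.not_gt]
          · simp [hi, h]
          · simp [hi, h, h.not_gt]
      simp only [this, Finset.sum_add_distrib, ← Finset.sum_mul]
      change A * (-B) + B * A = 0
      ring
  -- Here `lam` vanishes off `J`, so slack `1` there is orthogonal to it.
  · have hcase' := fun h => hcase (hJ.2 h)
    refine ⟨fun i => if i ∈ J then 0 else 1, fun i hi => by simp [hi], fun i hi => by simp [hi],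
      Finset.sum_eq_zero fun i _ => ?_⟩
    by_cases hi : i ∈ J
    · simp [hi]
    · have h1 : lam i ≤ 0 := not_lt.1 fun h => hcase ⟨i, hi, h⟩
      have h2 : 0 ≤ lam i := not_lt.1 fun h => hcase' ⟨i, hi, h⟩
      simp [hi, le_antisymm h1 h2]

/-- The exposing functional is constant on the hull of `J` and strictly smaller at all other points,
so a balanced set is recovered from its face. -/
theorem HasDependency.preimage_convexHull (hp : HasDependency p lam) {J : Set ι}
    (hJ : Balanced lam J) : {i | p i ∈ convexHull ℝ (p '' J)} = J := by
  obtain ⟨l, a, h1, h2⟩ := hp.exists_exposing hJ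
  ext i
  constructor
  · intro hi
    have : convexHull ℝ (p '' {i | l (p i) = a}) = _ :=
      (sep_convexHull_range p l.toLinearMap a h1).symm
    rw [h2] at this
    have hi' : p i ∈ convexHull ℝ (p '' J) := hi
    rw [this] at hi'
    rw [← h2]
    exact hi'.2
  · intro hi
    exact subset_convexHull _ _ (mem_image_of_mem _ hi)

omit [FiniteDimensional ℝ E] in
theorem HasDependency.balanced_empty (hp : HasDependency p lam) : Balanced lam ∅ := by
  have := hp.balanced_of_le 0 1 (by simp)
  simpa using this

theorem HasDependency.isExposed_iff (hp : HasDependency p lam) (F : Set E) :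
    IsExposed ℝ (convexHull ℝ (range p)) F ↔ ∃ J, Balanced lam J ∧ F = convexHull ℝ (p '' J) := by
  rw [isExposed_convexHull_range_iff]
  constructor
  · rintro (rfl | ⟨l, a, h1, -, rfl⟩)
    · exact ⟨∅, hp.balanced_empty, by simp⟩
    · exact ⟨_, hp.balanced_of_le l a h1, rfl⟩
  · rintro ⟨J, hJ, rfl⟩
    rcases J.eq_empty_or_nonempty with rfl | ⟨i, hi⟩
    · left; simp
    · right
      obtain ⟨l, a, h1, h2⟩ := hp.exists_exposing hJ
      exact ⟨l, a, h1, ⟨i, by rw [← h2] at hi; exact hi⟩, by rw [h2]⟩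

theorem HasDependency.mem_extremePoints (hp : HasDependency p lam) {i : ι}
    (hi : Balanced lam {i}) : p i ∈ extremePoints ℝ (convexHull ℝ (range p)) := by
  have h1 : IsExposed ℝ (convexHull ℝ (range p)) {p i} :=
    (hp.isExposed_iff _).2 ⟨{i}, hi, by simp⟩
  exact isExtreme_singleton.1 h1.isExtreme

theorem HasDependency.injective (hp : HasDependency p lam) (h : ∀ i, Balanced lam {i}) :
    Function.Injective p := by
  intro i j hij
  have : i ∈ {k | p k ∈ convexHull ℝ (p '' {j})} := by
    simp [hij]
  rw [hp.preimage_convexHull (h j)] at this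
  exact this

theorem HasDependency.extremePoints_eq (hp : HasDependency p lam) (h : ∀ i, Balanced lam {i}) :
    extremePoints ℝ (convexHull ℝ (range p)) = range p := by
  apply extremePoints_convexHull_subset.antisymm
  rintro _ ⟨i, rfl⟩
  exact hp.mem_extremePoints (h i)

-- Unlike the balanced case, `J` is arbitrary: an extreme point of the whole hull lying in a smaller
-- hull is extreme there, hence one of its generators.
omit [Fintype ι] [FiniteDimensional ℝ E] in
theorem preimage_convexHull_of_extreme (hinj : Function.Injective p)
    (hext : extremePoints ℝ (convexHull ℝ (range p)) = range p) (J : Set ι) :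
    {i | p i ∈ convexHull ℝ (p '' J)} = J := by
  ext i
  constructor
  · intro hi
    have h1 : p i ∈ extremePoints ℝ (convexHull ℝ (range p)) := by
      rw [hext]; exact mem_range_self i
    have h2 := inter_extremePoints_subset_extremePoints_of_subset
      (convexHull_mono (image_subset_range p J)) ⟨hi, h1⟩
    obtain ⟨j, hj, hj'⟩ := extremePoints_convexHull_subset h2
    exact hinj hj' ▸ hj
  · intro hi
    exact subset_convexHull _ _ (mem_image_of_mem _ hi)

theorem HasDependency.isProperFace_iff (hp : HasDependency p lam)
    (h : ∀ i, Balanced lam {i}) (J : Set ι) :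
    IsProperFace (convexHull ℝ (range p)) (convexHull ℝ (p '' J)) ↔
      Balanced lam J ∧ J ≠ univ := by
  have hpre := preimage_convexHull_of_extreme (hp.injective h) (hp.extremePoints_eq h)
  unfold IsProperFace IsFace
  rw [hp.isExposed_iff]
  constructor
  · rintro ⟨⟨J', h1, h2⟩, h3⟩
    have : J = J' := by
      rw [← hpre J, ← hpre J', h2]
    subst this
    refine ⟨h1, ?_⟩
    rintro rfl
    rw [image_univ] at h3
    exact h3 rfl
  · rintro ⟨h1, h2⟩
    refine ⟨⟨J, h1, rfl⟩, fun h3 => h2 ?_⟩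
    rw [← hpre J, h3]
    ext i
    simpa using subset_convexHull ℝ (range p) (mem_range_self i)

/-- The face lattice of the convex hull of `p`, in terms of `lam` only. -/
noncomputable def HasDependency.faceOrderIso (hp : HasDependency p lam) :
    {F : Set E // IsFace (convexHull ℝ (range p)) F} ≃o {J : Set ι // Balanced lam J} where
  toFun F := ⟨{i | p i ∈ F.1}, by
    obtain ⟨F, hF⟩ := F
    obtain ⟨J, hJ, rfl⟩ := (hp.isExposed_iff F).1 hF
    rwa [hp.preimage_convexHull hJ]⟩
  invFun J := ⟨convexHull ℝ (p '' J.1), (hp.isExposed_iff _).2 ⟨J.1, J.2, rfl⟩⟩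
  left_inv F := by
    obtain ⟨F, hF⟩ := F
    obtain ⟨J, hJ, rfl⟩ := (hp.isExposed_iff F).1 hF
    simp only [hp.preimage_convexHull hJ]
  right_inv J := Subtype.ext (hp.preimage_convexHull J.2)
  map_rel_iff' := by
    rintro ⟨F, hF⟩ ⟨G, hG⟩
    constructor
    · intro h
      obtain ⟨J, hJ, rfl⟩ := (hp.isExposed_iff F).1 hF
      obtain ⟨J', hJ', rfl⟩ := (hp.isExposed_iff G).1 hG
      have h' : {i | p i ∈ convexHull ℝ (p '' J)} ⊆ {i | p i ∈ convexHull ℝ (p '' J')} := h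
      rw [hp.preimage_convexHull hJ, hp.preimage_convexHull hJ'] at h'
      exact convexHull_mono (image_mono h')
    · intro h i hi
      exact h hi

/-- Being balanced depends only on signs, so a sign-preserving bijection of indices transports the
face lattice. -/
theorem HasDependency.combEquiv {E' ι' : Type*} [NormedAddCommGroup E'] [NormedSpace ℝ E']
    [FiniteDimensional ℝ E'] [Fintype ι'] {p' : ι' → E'} {lam' : ι' → ℝ}
    (hp : HasDependency p lam) (hp' : HasDependency p' lam') (e : ι ≃ ι')
    (hpos : ∀ i, 0 < lam i ↔ 0 < lam' (e i)) (hneg : ∀ i, lam i < 0 ↔ lam' (e i) < 0) :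
    CombEquiv (convexHull ℝ (range p)) (convexHull ℝ (range p')) := by
  have hb : ∀ J : Set ι, Balanced lam' (e.symm ⁻¹' J) ↔ Balanced lam J := by
    intro J
    unfold Balanced
    refine iff_congr (e.symm.exists_congr fun i => ?_) (e.symm.exists_congr fun i => ?_)
    · rw [hpos, e.apply_symm_apply, mem_preimage]
    · rw [hneg, e.apply_symm_apply, mem_preimage]
  let Φ : {J : Set ι // Balanced lam J} ≃o {J : Set ι' // Balanced lam' J} :=
    { toFun := fun J => ⟨e.symm ⁻¹' J.1, (hb _).2 J.2⟩
      invFun := fun J => ⟨e ⁻¹' J.1, (hb _).1 (by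
        rw [← preimage_comp, e.self_comp_symm, preimage_id]; exact J.2)⟩
      left_inv := fun J => Subtype.ext (by
        dsimp only
        rw [← preimage_comp, e.symm_comp_self, preimage_id])
      right_inv := fun J => Subtype.ext (by
        dsimp only
        rw [← preimage_comp, e.self_comp_symm, preimage_id])
      map_rel_iff' := fun {J J'} => e.symm.surjective.preimage_subset_preimage_iff }
  exact ⟨hp.faceOrderIso.trans (Φ.trans hp'.faceOrderIso.symm)⟩

theorem HasDependency.isFoldPyramid (hp : HasDependency p lam) (T : Set ι) (S : Finset ι)
    (hS : ∀ i ∈ S, lam i = 0) (hTS : ∀ i ∈ S, i ∉ T) :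
    IsFoldPyramid (convexHull ℝ (p '' T)) S.card (convexHull ℝ (p '' (T ∪ S))) := by
  classical
  induction S using Finset.induction_on with
  | empty => simp [IsFoldPyramid]
  | insert a S ha ih =>
    rw [Finset.card_insert_of_notMem ha]
    refine ⟨_, p a, ih (fun i hi => hS i (Finset.mem_insert_of_mem hi))
      (fun i hi => hTS i (Finset.mem_insert_of_mem hi)), ?_, ?_⟩
    · rw [affineSpan_convexHull]
      -- As `lam a = 0`, the indicator of `a` is orthogonal to `lam`: some functional is constant on
      -- all the other points and differs at `p a`.
      obtain ⟨l, b, hl⟩ := hp.exists_functional (Pi.single a 1)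
        (by simp [Pi.single_apply, hS a (Finset.mem_insert_self a S)])
      intro hmem
      have hle : affineSpan ℝ (p '' (T ∪ S)) ≤
          AffineSubspace.comap l.toLinearMap.toAffineMap (affineSpan ℝ {b}) := by
        rw [affineSpan_le]
        rintro _ ⟨i, hi, rfl⟩
        have hia : i ≠ a := by
          rintro rfl
          rcases hi with hi | hi
          · exact hTS i (Finset.mem_insert_self i S) hi
          · exact ha hi
        simp [hl, hia]
      have := hle hmem
      simp [hl] at this
    · have : p '' (T ∪ ↑(insert a S)) = insert (p a) (p '' (T ∪ S)) := by
        rw [Finset.coe_insert, union_insert, image_insert_eq]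
      rw [this]
      apply Subset.antisymm
      · exact convexHull_mono (insert_subset_insert (subset_convexHull _ _))
      · refine convexHull_min (insert_subset ?_ ?_) (convex_convexHull ℝ _)
        · exact subset_convexHull _ _ (mem_insert _ _)
        · exact convexHull_mono (subset_insert _ _)

end Dependencies

/-! ### Facets of a simplex, points beyond and beneath them -/

section Simplex

variable {E : Type*} [NormedAddCommGroup E] [NormedSpace ℝ E] [FiniteDimensional ℝ E]
  {κ : Type*} [Fintype κ] {q : κ → E}

omit [Fintype κ] in
theorem balanced_zero (J : Set κ) : Balanced (0 : κ → ℝ) J := by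
  simp [Balanced]

/-- Every subset spans a face, of dimension one less than its size. `Nontrivial κ` is needed because
over a single point the opposite face is empty and does not count as a facet. -/
theorem isFacet_simplex_iff [Nontrivial κ] (hq : AffineIndependent ℝ q) (F : Set E) :
    IsFacet (convexHull ℝ (range q)) F ↔ ∃ i, F = convexHull ℝ (q '' {i}ᶜ) := by
  classical
  have hp := hasDependency_zero_iff.2 hq
  have hrank : ∀ J : Set κ, J.Nonempty →
      Module.finrank ℝ (vectorSpan ℝ (convexHull ℝ (q '' J))) + 1 = J.ncard := by
    intro J hJ
    have h1 : AffineIndependent ℝ (fun i : J => q i) := hq.subtype J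
    have h2 : 0 < Fintype.card J := Fintype.card_pos_iff.2 hJ.to_subtype
    rw [finrank_vectorSpan_convexHull, image_eq_range,
      h1.finrank_vectorSpan (n := Fintype.card J - 1) (by omega), ← Nat.card_coe_set_eq,
      Nat.card_eq_fintype_card]
    omega
  have hfull := hrank univ univ_nonempty
  rw [image_univ, ncard_univ, Nat.card_eq_fintype_card] at hfull
  unfold IsFacet IsFace
  rw [hp.isExposed_iff]
  constructor
  · rintro ⟨⟨J, -, rfl⟩, h1, h2⟩
    rw [convexHull_nonempty_iff, image_nonempty] at h1
    have h3 := hrank J h1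
    have h4 : Jᶜ.ncard = 1 := by
      have := ncard_add_ncard_compl J
      rw [Nat.card_eq_fintype_card] at this
      omega
    obtain ⟨i, hi⟩ := ncard_eq_one.1 h4
    exact ⟨i, by rw [← hi, compl_compl]⟩
  · rintro ⟨i, rfl⟩
    have hne : ({i}ᶜ : Set κ).Nonempty := by
      obtain ⟨j, hj⟩ := exists_ne i
      exact ⟨j, hj⟩
    refine ⟨⟨_, balanced_zero _, rfl⟩, ?_, ?_⟩
    · rw [convexHull_nonempty_iff, image_nonempty]
      exact hne
    · have := hrank _ hne
      have h4 := ncard_add_ncard_compl ({i} : Set κ)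
      rw [Nat.card_eq_fintype_card, ncard_singleton] at h4
      omega

theorem facet_simplex_injective (hq : AffineIndependent ℝ q) :
    Function.Injective (fun i : κ => convexHull ℝ (q '' {i}ᶜ)) := by
  intro i j hij
  have hp := hasDependency_zero_iff.2 hq
  have h := congrArg (fun F => {k | q k ∈ F}) hij
  simp only [hp.preimage_convexHull (balanced_zero _)] at h
  exact singleton_injective (compl_injective h)

omit [FiniteDimensional ℝ E] in
theorem apply_eq_of_facet_simplex {l : E →L[ℝ] ℝ} {a : ℝ} {i : κ}
    (h : ∀ j, j ≠ i → l (q j) = a) {w : κ → ℝ} (hw : ∑ j, w j = 1) :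
    l (∑ j, w j • q j) = a + w i * (l (q i) - a) := by
  classical
  have : ∀ j, w j * l (q j) = w j * a + if j = i then w i * (l (q i) - a) else 0 := by
    intro j
    split_ifs with hj
    · subst hj; ring
    · rw [h j hj]; ring
  simp only [map_sum, map_smul, smul_eq_mul, this, Finset.sum_add_distrib, ← Finset.sum_mul, hw]
  simp

/-- A functional `l ≤ a` defining the facet opposite `q i` satisfies `l v - a = w i * (l (q i) - a)`
with a negative second factor. -/
theorem isBeyond_simplex_iff (hq : AffineIndependent ℝ q) (i : κ) {w : κ → ℝ}
    (hw : ∑ j, w j = 1) :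
    (IsBeyond (convexHull ℝ (range q)) (convexHull ℝ (q '' {i}ᶜ)) (∑ j, w j • q j) ↔ w i < 0) ∧
    (IsBeneath (convexHull ℝ (range q)) (convexHull ℝ (q '' {i}ᶜ)) (∑ j, w j • q j) ↔
      0 < w i) := by
  classical
  have hp := hasDependency_zero_iff.2 hq
  -- Both relations only assert that some functional exists, so the computation must hold for every
  -- functional defining the facet.
  have hval : ∀ (l : E →L[ℝ] ℝ) (a : ℝ), (∀ x ∈ convexHull ℝ (range q), l x ≤ a) →
      convexHull ℝ (q '' {i}ᶜ) = {x ∈ convexHull ℝ (range q) | l x = a} →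
      l (∑ j, w j • q j) = a + w i * (l (q i) - a) ∧ l (q i) - a < 0 := by
    intro l a h1 h2
    have h3 := hp.preimage_convexHull (balanced_zero ({i}ᶜ : Set κ))
    rw [h2] at h3
    have h4 : ∀ j, l (q j) = a ↔ j ≠ i := by
      intro j
      have := Set.ext_iff.1 h3 j
      simpa [subset_convexHull ℝ (range q) (mem_range_self j)] using this
    refine ⟨apply_eq_of_facet_simplex (fun j hj => (h4 j).2 hj) hw, ?_⟩
    have h5 : l (q i) ≠ a := fun h => (h4 i).1 h rfl
    exact sub_neg.2 (lt_of_le_of_ne (h1 _ (subset_convexHull _ _ (mem_range_self i))) h5)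
  obtain ⟨l, a, hl⟩ := hp.exists_functional (Pi.single i 1) (by simp)
  have hle : ∀ j, l (q j) ≤ a := by
    intro j
    rw [hl, Pi.single_apply]
    split_ifs <;> simp
  have hface : convexHull ℝ (q '' {i}ᶜ) = {x ∈ convexHull ℝ (range q) | l x = a} := by
    refine Eq.trans ?_ (sep_convexHull_range q l.toLinearMap a hle).symm
    congr 2
    ext j
    simp [hl, Pi.single_apply]
  have hle' : ∀ x ∈ convexHull ℝ (range q), l x ≤ a := fun x hx =>
    le_of_mem_convexHull_range (l := l.toLinearMap) hle hx
  constructor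
  · constructor
    · rintro ⟨l, a, h1, h2, h3⟩
      obtain ⟨h4, h5⟩ := hval l a h1 h2
      rw [h4] at h3
      by_contra! hcon
      nlinarith [mul_nonneg hcon (neg_pos.2 h5).le]
    · intro h
      refine ⟨l, a, hle', hface, ?_⟩
      obtain ⟨h4, h5⟩ := hval l a hle' hface
      rw [h4]
      linarith [mul_pos_of_neg_of_neg h h5]
  · constructor
    · rintro ⟨l, a, h1, h2, h3⟩
      obtain ⟨h4, h5⟩ := hval l a h1 h2
      rw [h4] at h3
      by_contra! hcon
      nlinarith [mul_nonneg_of_nonpos_of_nonpos hcon h5.le]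
    · intro h
      refine ⟨l, a, hle', hface, ?_⟩
      obtain ⟨h4, h5⟩ := hval l a hle' hface
      rw [h4]
      linarith [mul_neg_of_pos_of_neg h h5]

variable {ι : Type*} [Fintype ι] {p : ι → E} {lam : ι → ℝ}

/-- The points other than `p i₀` form a simplex in which `p i₀` has barycentric coordinates `-(lam i
/ lam i₀)`: it is beyond the facets opposite the indices with the sign of `i₀`. One such index puts
it outside the simplex. -/
theorem HasDependency.isTPolytope (hp : HasDependency p lam) (hlam : ∀ i, lam i ≠ 0) (i₀ : ι)
    (h3 : 3 ≤ Fintype.card ι) (hsame : ∃ i, i ≠ i₀ ∧ 0 < lam i / lam i₀) :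
    IsTPolytope (Fintype.card ι - 2) {i | i ≠ i₀ ∧ 0 < lam i / lam i₀}.ncard
      (convexHull ℝ (range p)) := by
  classical
  let q : ({i₀}ᶜ : Set ι) → E := fun i => p i
  let w : ({i₀}ᶜ : Set ι) → ℝ := fun i => -(lam i / lam i₀)
  have hq : AffineIndependent ℝ q := hp.affineIndependent_subtype {i₀}ᶜ ⟨i₀, by simp, hlam i₀⟩
  obtain ⟨hw, hv⟩ := hp.eq_sum_compl (hlam i₀)
  change ∑ i, w i = 1 at hw
  change ∑ i, w i • q i = p i₀ at hv
  have hcard : Fintype.card ({i₀}ᶜ : Set ι) + 1 = Fintype.card ι := by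
    rw [Fintype.card_compl_set]
    simp only [Fintype.card_unique]
    omega
  have hnt : Nontrivial ({i₀}ᶜ : Set ι) := Fintype.one_lt_card_iff_nontrivial.1 (by omega)
  have hrange : range p = insert (p i₀) (range q) := by
    rw [← image_eq_range, ← image_insert_eq, ← image_univ]
    congr 1
    ext i
    simp [em]
  have hdim : Module.finrank ℝ (vectorSpan ℝ (convexHull ℝ (range q))) = Fintype.card ι - 2 := by
    rw [finrank_vectorSpan_convexHull, hq.finrank_vectorSpan (n := Fintype.card ι - 2) (by omega)]
  have hfin : range q = ((Finset.univ.image q : Finset E) : Set E) := by simp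
  have hset : ∀ (R : Set E → Set E → E → Prop) (s : Set ι), s ⊆ {i₀}ᶜ →
      (∀ i : ({i₀}ᶜ : Set ι), R (convexHull ℝ (range q)) (convexHull ℝ (q '' {i}ᶜ)) (p i₀) ↔
        (i : ι) ∈ s) →
      {F : Set E | IsFacet (convexHull ℝ (range q)) F ∧ R (convexHull ℝ (range q)) F (p i₀)}.ncard
        = s.ncard := by
    intro R s hs hR
    have : {F : Set E | IsFacet (convexHull ℝ (range q)) F ∧
        R (convexHull ℝ (range q)) F (p i₀)} =
        (fun i => convexHull ℝ (q '' {i}ᶜ)) '' (Subtype.val ⁻¹' s) := by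
      ext F
      simp only [mem_ofPred_eq, mem_image, isFacet_simplex_iff hq]
      constructor
      · rintro ⟨⟨i, rfl⟩, h⟩
        exact ⟨i, (hR i).1 h, rfl⟩
      · rintro ⟨i, hi, rfl⟩
        exact ⟨⟨i, rfl⟩, (hR i).2 hi⟩
    rw [this, ncard_image_of_injective _ (facet_simplex_injective hq),
      ncard_preimage_of_injective_subset_range Subtype.val_injective (by
        rw [Subtype.range_coe]; exact hs)]
  have hbeyond := hset IsBeyond {i | i ≠ i₀ ∧ 0 < lam i / lam i₀} (fun i hi => hi.1) (by
    intro i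
    rw [← hv, (isBeyond_simplex_iff hq i hw).1]
    have : (i : ι) ≠ i₀ := i.2
    simp [w, this])
  have hbeneath := hset IsBeneath {i | i ≠ i₀ ∧ lam i / lam i₀ < 0} (fun i hi => hi.1) (by
    intro i
    rw [← hv, (isBeyond_simplex_iff hq i hw).2]
    have : (i : ι) ≠ i₀ := i.2
    simp [w, this])
  refine ⟨convexHull ℝ (range q), p i₀, ?_, ⟨⟨Finset.univ.image q, by rw [← hfin]⟩, ?_, hdim⟩,
    ?_, ?_, ?_, hbeyond, ?_⟩
  · refine ⟨Finset.univ.image q, ?_, by rw [← hfin]⟩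
    have := hq.range
    rw [hfin] at this
    exact this
  · rw [convexHull_nonempty_iff]
    exact range_nonempty q
  · rw [affineSpan_convexHull]
    have := hp.mem_affineSpan_compl (hlam i₀)
    rwa [image_eq_range] at this
  · intro hmem
    obtain ⟨i, hi, hi'⟩ := hsame
    have h1 := (isBeyond_simplex_iff hq ⟨i, hi⟩ hw).1.2 (by simpa [w] using hi')
    obtain ⟨l, a, h2, -, h3⟩ := h1
    rw [hv] at h3
    exact absurd (h2 _ hmem) h3.not_ge
  · rw [hrange]
    apply Subset.antisymm
    · exact convexHull_mono (insert_subset_insert (subset_convexHull _ _))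
    · refine convexHull_min (insert_subset ?_ ?_) (convex_convexHull ℝ _)
      · exact subset_convexHull _ _ (mem_insert _ _)
      · exact convexHull_mono (subset_insert _ _)
  · rw [hbeneath, ← ncard_union_eq]
    · have : {i | i ≠ i₀ ∧ lam i / lam i₀ < 0} ∪ {i | i ≠ i₀ ∧ 0 < lam i / lam i₀} = {i₀}ᶜ := by
        ext i
        have : lam i / lam i₀ ≠ 0 := div_ne_zero (hlam i) (hlam i₀)
        simp only [mem_union, mem_ofPred_eq, mem_compl_iff, mem_singleton_iff, ← and_or_left,
          and_iff_left_iff_imp]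
        intro _
        exact lt_or_gt_of_ne this
      rw [this, ← Nat.card_coe_set_eq, Nat.card_eq_fintype_card]
      omega
    · rw [Set.disjoint_left]
      rintro i ⟨-, h1⟩ ⟨-, h2⟩
      exact lt_asymm h1 h2

end Simplex

/-! ### Points on the moment curve and alternating signs -/

section Cyclic

open Polynomial in
theorem sum_mul_eval_eq_zero {ι : Type*} [Fintype ι] {d : ℕ} {t μ : ι → ℝ}
    (h0 : ∑ i, μ i = 0) (h1 : ∀ j : Fin d, ∑ i, μ i * t i ^ ((j : ℕ) + 1) = 0)
    (f : ℝ[X]) (hf : f.natDegree < d + 1) : ∑ i, μ i * f.eval (t i) = 0 := by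
  simp only [eval_eq_sum_range' hf, Finset.mul_sum]
  rw [Finset.sum_comm]
  refine Finset.sum_eq_zero fun k hk => ?_
  have : ∀ i, μ i * (f.coeff k * t i ^ k) = f.coeff k * (μ i * t i ^ k) := fun i => by ring
  simp only [this, ← Finset.mul_sum]
  rcases k with _ | k
  · simp [h0]
  · have := h1 ⟨k, by simpa using hk⟩
    rw [this, mul_zero]

/-- A dependency annihilates all polynomials of degree at most `d`. Testing it on the one vanishing
at all parameters but two fixes the ratio of the two coefficients, so the dependencies form at most
a line. -/
theorem hasDependency_moment {d N : ℕ} (hN : N = d + 2) (t : Fin N → ℝ)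
    (ht : Function.Injective t) :
    HasDependency (fun (i : Fin N) (j : Fin d) => t i ^ ((j : ℕ) + 1))
      (fun i => (∏ j ∈ Finset.univ.erase i, (t i - t j))⁻¹) := by
  classical
  set lam : Fin N → ℝ := fun i => (∏ j ∈ Finset.univ.erase i, (t i - t j))⁻¹ with hlam
  have hne : ∀ i, ∏ j ∈ Finset.univ.erase i, (t i - t j) ≠ 0 := fun i =>
    Finset.prod_ne_zero_iff.2 fun j hj => sub_ne_zero.2 fun h =>
      (Finset.ne_of_mem_erase hj) (ht h).symm
  have hcoord : ∀ μ : Fin N → ℝ, (∑ i, μ i • fun (j : Fin d) => t i ^ ((j : ℕ) + 1)) = 0 ↔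
      ∀ j : Fin d, ∑ i, μ i * t i ^ ((j : ℕ) + 1) = 0 := by
    intro μ
    simp [funext_iff, Finset.sum_apply]
  have key : ∀ μ : Fin N → ℝ, ∑ i, μ i = 0 →
      (∀ j : Fin d, ∑ i, μ i * t i ^ ((j : ℕ) + 1) = 0) →
      ∀ i k, μ i * (lam i)⁻¹ = μ k * (lam k)⁻¹ := by
    intro μ h0 h1 i k
    by_cases hik : i = k
    · rw [hik]
    let S : Finset (Fin N) := (Finset.univ.erase i).erase k
    have hS : S = (Finset.univ.erase k).erase i := Finset.erase_right_comm
    have hki : k ∈ Finset.univ.erase i := Finset.mem_erase.2 ⟨Ne.symm hik, Finset.mem_univ _⟩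
    have hik' : i ∈ Finset.univ.erase k := Finset.mem_erase.2 ⟨hik, Finset.mem_univ _⟩
    have hcard : S.card = d := by
      rw [Finset.card_erase_of_mem hki, Finset.card_erase_of_mem (Finset.mem_univ _),
        Finset.card_univ, Fintype.card_fin]
      omega
    have hsum := sum_mul_eval_eq_zero h0 h1 (∏ j ∈ S, (Polynomial.X - Polynomial.C (t j))) (by
      rw [Polynomial.natDegree_finsetProd_X_sub_C_eq_card, hcard]; exact Nat.lt_succ_self d)
    simp only [Polynomial.eval_prod, Polynomial.eval_sub, Polynomial.eval_X,
      Polynomial.eval_C] at hsum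
    rw [← Finset.add_sum_erase _ _ (Finset.mem_univ i), ← Finset.add_sum_erase _ _ hki,
      Finset.sum_eq_zero, add_zero] at hsum
    · simp only [hlam, inv_inv]
      rw [← Finset.mul_prod_erase _ _ hki, ← Finset.mul_prod_erase _ _ hik', ← hS]
      change μ i * ((t i - t k) * ∏ j ∈ S, (t i - t j)) = _
      linear_combination (t i - t k) * hsum
    · intro j hj
      rw [Finset.prod_eq_zero hj (sub_self _), mul_zero]
  have hmul : ∀ μ : Fin N → ℝ, ∑ i, μ i = 0 →
      (∀ j : Fin d, ∑ i, μ i * t i ^ ((j : ℕ) + 1) = 0) → ∃ s : ℝ, μ = s • lam := by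
    intro μ h0 h1
    let k : Fin N := ⟨0, by omega⟩
    refine ⟨μ k * (lam k)⁻¹, funext fun i => ?_⟩
    rw [Pi.smul_apply, smul_eq_mul, ← key μ h0 h1 i k, mul_assoc,
      inv_mul_cancel₀ (inv_ne_zero (hne i)), mul_one]
  intro μ
  rw [hcoord]
  refine ⟨fun h => hmul μ h.1 h.2, ?_⟩
  rintro ⟨s, rfl⟩
  -- There are `d + 2` unknowns and `d + 1` equations, so a nonzero dependency exists; being a
  -- multiple of `lam`, it shows that `lam` is one itself.
  let T : (Fin N → ℝ) →ₗ[ℝ] ℝ × (Fin d → ℝ) :=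
    Fintype.linearCombination ℝ (fun i => ((1 : ℝ), fun j : Fin d => t i ^ ((j : ℕ) + 1)))
  have hker : LinearMap.ker T ≠ ⊥ := LinearMap.ker_ne_bot_of_finrank_lt (by simp [hN]; omega)
  obtain ⟨ν, hν, hν0⟩ := Submodule.exists_mem_ne_zero_of_ne_bot hker
  rw [LinearMap.mem_ker] at hν
  simp only [T, Fintype.linearCombination_apply] at hν
  have h0 : ∑ i, ν i = 0 := by
    have := congrArg Prod.fst hν
    simpa [Prod.fst_sum] using this
  have h1 : ∀ j : Fin d, ∑ i, ν i * t i ^ ((j : ℕ) + 1) = 0 := by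
    intro j
    have := congrFun (congrArg Prod.snd hν) j
    simpa [Prod.snd_sum, Finset.sum_apply] using this
  obtain ⟨r, rfl⟩ := hmul ν h0 h1
  have hr : r ≠ 0 := by
    rintro rfl
    simp at hν0
  simp only [Pi.smul_apply, smul_eq_mul, mul_assoc, ← Finset.mul_sum] at h0 h1 ⊢
  refine ⟨?_, fun j => ?_⟩
  · rw [(mul_eq_zero.1 h0).resolve_left hr, mul_zero]
  · rw [(mul_eq_zero.1 (h1 j)).resolve_left hr, mul_zero]

/-- Exactly the `N - 1 - i` factors with `j > i` are negative. -/
theorem neg_one_pow_mul_nodal_pos {N : ℕ} (t : Fin N → ℝ) (ht : StrictMono t) (i : Fin N) :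
    0 < (-1 : ℝ) ^ (N - 1 - i : ℕ) * (∏ j ∈ Finset.univ.erase i, (t i - t j))⁻¹ := by
  classical
  have h1 : Finset.univ.erase i = Finset.Iio i ∪ Finset.Ioi i := by
    ext j
    simp [lt_or_lt_iff_ne]
  have h2 : Disjoint (Finset.Iio i) (Finset.Ioi i) := by
    rw [Finset.disjoint_left]
    intro j h h'
    exact lt_asymm (Finset.mem_Iio.1 h) (Finset.mem_Ioi.1 h')
  have h3 : ∏ j ∈ Finset.Ioi i, (t i - t j) =
      (-1 : ℝ) ^ (N - 1 - i : ℕ) * ∏ j ∈ Finset.Ioi i, (t j - t i) := by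
    rw [← Fin.card_Ioi, ← Finset.prod_const, ← Finset.prod_mul_distrib]
    exact Finset.prod_congr rfl fun j _ => by ring
  have h4 : 0 < ∏ j ∈ Finset.Ioi i, (t j - t i) :=
    Finset.prod_pos fun j hj => sub_pos.2 (ht (Finset.mem_Ioi.1 hj))
  have h5 : 0 < ∏ j ∈ Finset.Iio i, (t i - t j) :=
    Finset.prod_pos fun j hj => sub_pos.2 (ht (Finset.mem_Iio.1 hj))
  rw [h1, Finset.prod_union h2, h3]
  rcases neg_one_pow_eq_or ℝ (N - 1 - i : ℕ) with h | h <;> rw [h]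
  · positivity
  · have : (-1 : ℝ) * ((∏ j ∈ Finset.Iio i, (t i - t j)) *
        (-1 * ∏ j ∈ Finset.Ioi i, (t j - t i)))⁻¹ =
        ((∏ j ∈ Finset.Iio i, (t i - t j)) * ∏ j ∈ Finset.Ioi i, (t j - t i))⁻¹ := by
      field_simp
    rw [this]
    positivity

/-- The sign exponents at `i` and `i.rev` add up to the odd number `2 * m - 1`, so reversal
exchanges positive and negative entries. -/
theorem ncard_nodal_pos {m : ℕ} (t : Fin (2 * m) → ℝ) (ht : StrictMono t) :
    {i | 0 < (∏ j ∈ Finset.univ.erase i, (t i - t j))⁻¹}.ncard = m := by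
  set lam : Fin (2 * m) → ℝ := fun i => (∏ j ∈ Finset.univ.erase i, (t i - t j))⁻¹ with hlam
  have hsign : ∀ i, 0 < lam i ↔ ¬ 0 < lam i.rev := by
    intro i
    have h1 := neg_one_pow_mul_nodal_pos t ht i
    have h2 := neg_one_pow_mul_nodal_pos t ht i.rev
    have hi := i.2
    have h3 : ((2 * m - 1 - (i.rev : ℕ)) + (2 * m - 1 - i) : ℕ) = 2 * m - 1 := by
      rw [Fin.val_rev]; omega
    have h4 : (-1 : ℝ) ^ (2 * m - 1 - i.rev : ℕ) * (-1 : ℝ) ^ (2 * m - 1 - i : ℕ) = -1 := by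
      rw [← pow_add, h3]
      exact Odd.neg_one_pow ⟨m - 1, by omega⟩
    change 0 < _ * lam i at h1
    change 0 < _ * lam i.rev at h2
    rcases neg_one_pow_eq_or ℝ (2 * m - 1 - i : ℕ) with h | h
    · rw [h] at h1 h4
      rw [mul_one] at h4
      rw [h4] at h2
      constructor <;> intro <;> linarith
    · rw [h] at h1 h4
      have h5 : (-1 : ℝ) ^ (2 * m - 1 - i.rev : ℕ) = 1 := by linarith
      rw [h5] at h2
      constructor
      · intro; linarith
      · intro; linarith
  have h1 : {i | 0 < lam i}ᶜ = Fin.revPerm '' {i | 0 < lam i} := by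
    ext i
    rw [Equiv.image_eq_preimage_symm]
    simp only [mem_compl_iff, mem_ofPred_eq, mem_preimage, Fin.revPerm_symm, Fin.revPerm_apply]
    rw [hsign i, not_not]
  have h2 := ncard_add_ncard_compl {i | 0 < lam i}
  rw [h1, ncard_image_of_injective _ Fin.revPerm.injective, Nat.card_eq_fintype_card,
    Fintype.card_fin] at h2
  change {i | 0 < lam i}.ncard = m
  omega

theorem exists_equiv_pos_iff {ι ι' : Type*} [Fintype ι] [Fintype ι'] {lam : ι → ℝ} {lam' : ι' → ℝ}
    (h : Fintype.card ι = Fintype.card ι')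
    (hpos : {i | 0 < lam i}.ncard = {i | 0 < lam' i}.ncard) :
    ∃ e : ι ≃ ι', ∀ i, 0 < lam i ↔ 0 < lam' (e i) := by
  classical
  have h1 : Fintype.card {i // 0 < lam i} = Fintype.card {i // 0 < lam' i} := by
    rw [← Nat.card_eq_fintype_card, ← Nat.card_eq_fintype_card]
    exact hpos
  have h2 : Fintype.card {i // ¬ 0 < lam i} = Fintype.card {i // ¬ 0 < lam' i} := by
    rw [Fintype.card_subtype_compl, Fintype.card_subtype_compl, h, h1]
  let e₁ := Fintype.equivOfCardEq h1
  let e₂ := Fintype.equivOfCardEq h2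
  refine ⟨(Equiv.sumCompl _).symm.trans ((Equiv.sumCongr e₁ e₂).trans (Equiv.sumCompl _)), ?_⟩
  intro i
  by_cases hi : 0 < lam i
  · have h3 : (Equiv.sumCompl fun a => 0 < lam a).symm i = Sum.inl ⟨i, hi⟩ :=
      (Equiv.symm_apply_eq _).2 rfl
    simp only [Equiv.trans_apply, h3]
    exact iff_of_true hi (e₁ ⟨i, hi⟩).2
  · have h3 : (Equiv.sumCompl fun a => 0 < lam a).symm i = Sum.inr ⟨i, hi⟩ :=
      (Equiv.symm_apply_eq _).2 rfl
    simp only [Equiv.trans_apply, h3]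
    exact iff_of_false hi (e₂ ⟨i, hi⟩).2

theorem HasDependency.combEquiv_cyclicPolytope {E ι : Type*} [NormedAddCommGroup E]
    [NormedSpace ℝ E] [FiniteDimensional ℝ E] [Fintype ι] {p : ι → E} {lam : ι → ℝ}
    (hp : HasDependency p lam) (hlam : ∀ i, lam i ≠ 0) {m : ℕ} (hm : 1 ≤ m)
    (hcard : Fintype.card ι = 2 * m) (hpos : {i | 0 < lam i}.ncard = m)
    (t : Fin (2 * m) → ℝ) (ht : StrictMono t) :
    CombEquiv (convexHull ℝ (range p)) (cyclicPolytope (2 * m - 2) t) := by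
  have hp' := hasDependency_moment (d := 2 * m - 2) (by omega) t ht.injective
  have hne : ∀ i, (∏ j ∈ Finset.univ.erase i, (t i - t j))⁻¹ ≠ 0 := fun i h => by
    have := neg_one_pow_mul_nodal_pos t ht i
    rw [h, mul_zero] at this
    exact lt_irrefl _ this
  obtain ⟨e, he⟩ := exists_equiv_pos_iff (lam := lam)
    (lam' := fun i => (∏ j ∈ Finset.univ.erase i, (t i - t j))⁻¹) (by simpa using hcard)
    (hpos.trans (ncard_nodal_pos t ht).symm)
  refine hp.combEquiv hp' e he fun i => ?_
  have h1 := he i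
  have h2 := hlam i
  have h3 := hne (e i)
  constructor
  · intro h
    exact lt_of_le_of_ne (not_lt.1 fun h' => lt_asymm h (h1.2 h')) h3
  · intro h
    exact lt_of_le_of_ne (not_lt.1 fun h' => lt_asymm h (h1.1 h')) h2

end Cyclic

/-! ### A polytope is cut out by its facets -/

section Facets

variable {E : Type*} [NormedAddCommGroup E] [NormedSpace ℝ E]
  {ι : Type*} [Fintype ι] {p : ι → E}

/-- Among the functionals bounded by one on a finite family with sum zero, a linear objective is
maximized by one that is determined by the points where the bound is attained. -/
theorem exists_rigid_functional {u : ι → E} (hu : ∑ i, u i = 0) (c : ι → ℝ)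
    (l₀ : E →L[ℝ] ℝ) (hl₀ : ∀ i, l₀ (u i) ≤ 1) :
    ∃ l : E →L[ℝ] ℝ, (∀ i, l (u i) ≤ 1) ∧ ∑ i, c i * l₀ (u i) ≤ ∑ i, c i * l (u i) ∧
      ∀ g : E →L[ℝ] ℝ, (∀ i, l (u i) = 1 → g (u i) = 0) → ∀ i, g (u i) = 0 := by
  let T : (E →L[ℝ] ℝ) →ₗ[ℝ] (ι → ℝ) :=
    { toFun := fun l i => l (u i)
      map_add' := fun _ _ => rfl
      map_smul' := fun _ _ => rfl }
  -- Value vectors replace functionals: their coordinates are at most one and sum to zero, hence are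
  -- bounded below too, and `Q` is compact.
  let Q : Set (ι → ℝ) := {z | z ∈ LinearMap.range T ∧ ∀ i, z i ≤ 1}
  have hclosed : IsClosed Q := by
    have h1 : IsClosed (LinearMap.range T : Set (ι → ℝ)) := Submodule.closed_of_finiteDimensional _
    have h2 : IsClosed {z : ι → ℝ | ∀ i, z i ≤ 1} := by
      simp only [ofPred_forall]
      exact isClosed_iInter fun i => isClosed_le (continuous_apply i) continuous_const
    exact h1.inter h2
  have hsum : ∀ z ∈ Q, ∑ i, z i = 0 := by
    rintro _ ⟨⟨l, rfl⟩, -⟩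
    change ∑ i, l (u i) = 0
    rw [← map_sum, hu, map_zero]
  have hcompact : IsCompact Q := by
    classical
    refine (isCompact_Icc (a := fun _ : ι => -(Fintype.card ι : ℝ))
      (b := fun _ => 1)).of_isClosed_subset hclosed fun z hz => ⟨fun i => ?_, fun i => hz.2 i⟩
    have h1 := hsum z hz
    rw [← Finset.add_sum_erase _ _ (Finset.mem_univ i)] at h1
    have h2 : ∑ j ∈ Finset.univ.erase i, z j ≤ ∑ j ∈ Finset.univ.erase i, (1 : ℝ) :=
      Finset.sum_le_sum fun j _ => hz.2 j
    have h3 : ∑ j ∈ Finset.univ.erase i, (1 : ℝ) ≤ Fintype.card ι := by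
      rw [Finset.sum_const, nsmul_eq_mul, mul_one]
      exact_mod_cast Finset.card_le_univ _
    change -(Fintype.card ι : ℝ) ≤ z i
    linarith
  let G : (ι → ℝ) →L[ℝ] ℝ := LinearMap.toContinuousLinearMap (Fintype.linearCombination ℝ c)
  have hG : ∀ z, G z = ∑ i, c i * z i := by
    intro z
    simp [G, Fintype.linearCombination_apply, mul_comm]
  have hz₀ : T l₀ ∈ Q := ⟨⟨l₀, rfl⟩, hl₀⟩
  obtain ⟨y, hy, hymax⟩ := hcompact.exists_isMaxOn ⟨_, hz₀⟩ G.continuous.continuousOn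
  -- An extreme point of the set of maximizers is an extreme point of `Q`.
  have hexp : IsExposed ℝ Q (G.toExposed Q) := ContinuousLinearMap.toExposed.isExposed
  obtain ⟨z, hz⟩ := (hexp.isCompact hcompact).extremePoints_nonempty ⟨y, hy, hymax⟩
  have hz1 : z ∈ G.toExposed Q := hz.1
  have hzQ : z ∈ extremePoints ℝ Q := hexp.isExtreme.extremePoints_subset_extremePoints hz
  obtain ⟨⟨⟨l, rfl⟩, hl⟩, hmax⟩ := hz1
  refine ⟨l, hl, ?_, fun g hg => ?_⟩
  · have := hmax _ hz₀
    rwa [hG, hG] at this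
  -- If `g` vanishes where the bound is attained, `l ± ε • g` stay admissible for small `ε`, and
  -- extremality forces `g` to vanish on the whole family.
  · have hev : ∀ᶠ ε : ℝ in 𝓝[>] 0, ∀ i, l (u i) + ε * |g (u i)| ≤ 1 := by
      rw [eventually_all]
      intro i
      by_cases hi : l (u i) = 1
      · simp [hg i hi, hi]
      · have hcont : Continuous fun ε : ℝ => l (u i) + ε * |g (u i)| := by fun_prop
        have hlim : Tendsto (fun ε : ℝ => l (u i) + ε * |g (u i)|) (𝓝[>] 0) (𝓝 (l (u i))) := by
          have := (hcont.tendsto 0).mono_left (nhdsWithin_le_nhds (s := Ioi 0))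
          simpa using this
        exact (hlim.eventually (gt_mem_nhds (lt_of_le_of_ne (hl i) hi))).mono fun _ h => h.le
    obtain ⟨ε, hε, hε0⟩ := (hev.and self_mem_nhdsWithin).exists
    have hε0' : (0 : ℝ) < ε := hε0
    have h1 : T (l + ε • g) ∈ Q := by
      refine ⟨⟨_, rfl⟩, fun i => ?_⟩
      change l (u i) + ε * g (u i) ≤ 1
      nlinarith [hε i, le_abs_self (g (u i))]
    have h2 : T (l - ε • g) ∈ Q := by
      refine ⟨⟨_, rfl⟩, fun i => ?_⟩
      change l (u i) - ε * g (u i) ≤ 1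
      nlinarith [hε i, neg_abs_le (g (u i))]
    have h3 := hzQ.2 h1 h2 ⟨1/2, 1/2, by norm_num, by norm_num, by norm_num, by
      rw [← map_smul, ← map_smul, ← map_add]
      congr 1
      module⟩
    intro i
    have h4 : l (u i) + ε * g (u i) = l (u i) := congrFun h3 i
    have h5 : ε * g (u i) = 0 := by linarith
    exact (mul_eq_zero.1 h5).resolve_left hε0'.ne'

theorem vectorSpan_le_of_sub_mem {s : Set E} (o : E) (S : Submodule ℝ E)
    (h : ∀ x ∈ s, x - o ∈ S) : vectorSpan ℝ s ≤ S := by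
  rw [vectorSpan_def, Submodule.span_le]
  rintro _ ⟨x, hx, y, hy, rfl⟩
  have := S.sub_mem (h x hx) (h y hy)
  simpa using this

theorem apply_eq_zero_of_mem_vectorSpan {s : Set E} {l : E →ₗ[ℝ] ℝ} {a : ℝ}
    (h : ∀ x ∈ s, l x = a) {u : E} (hu : u ∈ vectorSpan ℝ s) : l u = 0 := by
  have : vectorSpan ℝ s ≤ LinearMap.ker l := by
    rw [vectorSpan_def, Submodule.span_le]
    rintro _ ⟨x, hx, y, hy, rfl⟩
    simp [h x hx, h y hy]
  exact this hu

variable [FiniteDimensional ℝ E]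

/-- A polytope is cut out of its affine hull by its facets. -/
theorem exists_isFacet_isBeyond (p : ι → E) {x : E} (hx : x ∈ affineSpan ℝ (range p))
    (hxP : x ∉ convexHull ℝ (range p)) :
    ∃ F, IsFacet (convexHull ℝ (range p)) F ∧ IsBeyond (convexHull ℝ (range p)) F x := by
  classical
  obtain ⟨c, hc1, hc2⟩ := eq_affineCombination_of_mem_affineSpan_of_fintype hx
  rw [Finset.affineCombination_eq_linear_combination _ _ _ hc1] at hc2
  have hne : Nonempty ι := by
    by_contra hemp
    rw [not_nonempty_iff] at hemp
    simp at hc1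
  have hN : (Fintype.card ι : ℝ) ≠ 0 := Nat.cast_ne_zero.2 Fintype.card_ne_zero
  -- Centering at the barycenter makes the vectors `p i - o` sum to zero; with the affine
  -- coordinates `c` of `x` as objective, the quantity maximized is `l x - l o`.
  set o : E := (Fintype.card ι : ℝ)⁻¹ • ∑ i, p i with ho
  have hoP : o ∈ convexHull ℝ (range p) := by
    rw [mem_convexHull_range_iff]
    refine ⟨fun _ => (Fintype.card ι : ℝ)⁻¹, fun i => by positivity, ?_, ?_⟩
    · simp [hN]
    · rw [ho, Finset.smul_sum]
  have hu : ∑ i, (p i - o) = 0 := by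
    rw [Finset.sum_sub_distrib, Finset.sum_const, Finset.card_univ, ← Nat.cast_smul_eq_nsmul ℝ, ho,
      smul_inv_smul₀ hN, sub_self]
  have hxo : ∀ l : E →L[ℝ] ℝ, ∑ i, c i * l (p i - o) = l x - l o := by
    intro l
    rw [hc2]
    simp only [map_sub, mul_sub, Finset.sum_sub_distrib, ← Finset.sum_mul, hc1, map_sum, map_smul,
      smul_eq_mul, one_mul]
  obtain ⟨f, r, hf1, hf2⟩ := geometric_hahn_banach_closed_point (convex_convexHull ℝ (range p))
    ((finite_range p).isClosed_convexHull (𝕜 := ℝ)) hxP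
  have hs : 0 < r - f o := sub_pos.2 (hf1 o hoP)
  obtain ⟨l, hl1, hl2, hl3⟩ := exists_rigid_functional hu c ((r - f o)⁻¹ • f) (fun i => by
    have := hf1 _ (subset_convexHull _ _ (mem_range_self i))
    rw [smul_apply, smul_eq_mul, inv_mul_le_iff₀ hs, map_sub]
    linarith)
  rw [hxo, hxo] at hl2
  have hl4 : l o + 1 < l x := by
    have h1 : 1 < (r - f o)⁻¹ * (f x - f o) := by
      rw [lt_inv_mul_iff₀ hs]
      linarith
    simp only [smul_apply, smul_eq_mul] at hl2
    linarith
  have hle : ∀ i, l (p i) ≤ l o + 1 := by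
    intro i
    have := hl1 i
    rw [map_sub] at this
    linarith
  have hact : ∀ i, l (p i - o) = 1 ↔ l (p i) = l o + 1 := by
    intro i
    rw [map_sub]
    constructor <;> intro <;> linarith
  -- With no contact point, rigidity would make `l` vanish on every `p i - o`, giving `l x = l o`.
  have hA : ∃ i, l (p i) = l o + 1 := by
    by_contra! hcon
    have h0 := hl3 l fun i hi => absurd ((hact i).1 hi) (hcon i)
    have h1 := hxo l
    simp only [h0, mul_zero, Finset.sum_const_zero] at h1
    linarith
  obtain ⟨k, hk⟩ := hA
  have hface := sep_convexHull_range p l.toLinearMap (l o + 1) hle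
  refine ⟨convexHull ℝ (p '' {i | l (p i) = l o + 1}),
    ⟨(isExposed_convexHull_range_iff p _).2 (Or.inr ⟨l, _, hle, ⟨k, hk⟩, rfl⟩), ?_, ?_⟩,
    l, l o + 1, fun y hy => le_of_mem_convexHull_range (l := l.toLinearMap) hle hy, hface.symm, hl4⟩
  · exact ⟨p k, subset_convexHull _ _ ⟨k, hk, rfl⟩⟩
  rw [finrank_vectorSpan_convexHull, finrank_vectorSpan_convexHull]
  have hk' : p k - o ∉ vectorSpan ℝ (p '' {i | l (p i) = l o + 1}) := by
    intro hmem
    have h1 := apply_eq_zero_of_mem_vectorSpan (l := l.toLinearMap) (a := l o + 1) (by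
      rintro _ ⟨i, hi, rfl⟩
      exact hi) hmem
    have h2 := (hact k).2 hk
    change l (p k - o) = 0 at h1
    linarith
  rw [← Submodule.finrank_sup_span_singleton hk']
  suffices h : vectorSpan ℝ (p '' {i | l (p i) = l o + 1}) ⊔ Submodule.span ℝ {p k - o} =
      vectorSpan ℝ (range p) by rw [h]
  -- A functional killing the contact vectors kills all `p i - o`, so the contact vectors span; this
  -- gives the face codimension one.
  have hspan : ∀ i, p i - o ∈ Submodule.span ℝ ((fun i => p i - o) '' {i | l (p i) = l o + 1}) := by
    intro i
    by_contra hi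
    obtain ⟨g, hg1, hg2⟩ := Submodule.exists_dual_map_eq_bot_of_notMem hi inferInstance
    refine hg1 (hl3 (LinearMap.toContinuousLinearMap g) (fun j hj => ?_) i)
    have : g (p j - o) ∈ Submodule.map g
        (Submodule.span ℝ ((fun i => p i - o) '' {i | l (p i) = l o + 1})) :=
      Submodule.mem_map_of_mem (Submodule.subset_span ⟨j, (hact j).1 hj, rfl⟩)
    rw [hg2, Submodule.mem_bot] at this
    exact this
  apply le_antisymm
  · refine sup_le (vectorSpan_mono _ (image_subset_range _ _)) ?_
    rw [Submodule.span_singleton_le_iff_mem]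
    have : p k - o = (Fintype.card ι : ℝ)⁻¹ • ∑ i, (p k - p i) := by
      rw [Finset.sum_sub_distrib, Finset.sum_const, Finset.card_univ, ← Nat.cast_smul_eq_nsmul ℝ,
        smul_sub, inv_smul_smul₀ hN]
    rw [this]
    exact Submodule.smul_mem _ _ (Submodule.sum_mem _ fun i _ =>
      vsub_mem_vectorSpan ℝ (mem_range_self k) (mem_range_self i))
  · refine vectorSpan_le_of_sub_mem o _ ?_
    rintro _ ⟨i, rfl⟩
    refine (Submodule.span_le.2 ?_) (hspan i)
    rintro _ ⟨j, hj, rfl⟩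
    have : p j - o = (p j - p k) + (p k - o) := by abel
    simp only [this]
    refine Submodule.add_mem_sup ?_ (Submodule.mem_span_singleton_self _)
    exact vsub_mem_vectorSpan ℝ (mem_image_of_mem _ hj) (mem_image_of_mem _ hk)

/-- Frees `IsBeyond` from its existential: a facet has codimension one, so on the affine hull all
functionals defining it have the same positive side. -/
theorem IsBeyond.lt_apply {P F : Set E} {x : E} (hF : IsFacet P F) (hx : x ∈ affineSpan ℝ P)
    (hb : IsBeyond P F x) {l : E →L[ℝ] ℝ} {a : ℝ} (hl : ∀ y ∈ P, l y ≤ a)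
    (hlF : F = {y ∈ P | l y = a}) : a < l x := by
  obtain ⟨l', a', hl', hlF', hx'⟩ := hb
  obtain ⟨-, ⟨y, hy⟩, hdim⟩ := hF
  have hsub : F ⊆ P := by rw [hlF]; exact sep_subset _ _
  have hne : ∃ z ∈ P, z ∉ F := by
    by_contra! hcon
    have : F = P := hsub.antisymm hcon
    rw [this] at hdim
    omega
  obtain ⟨z, hz, hzF⟩ := hne
  have e1 : ∀ w ∈ F, l w = a := fun w hw => by rw [hlF] at hw; exact hw.2
  have e2 : ∀ w ∈ F, l' w = a' := fun w hw => by rw [hlF'] at hw; exact hw.2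
  have h1 : l z < a := lt_of_le_of_ne (hl z hz) fun h => hzF (by rw [hlF]; exact ⟨hz, h⟩)
  have h2 : l' z < a' := lt_of_le_of_ne (hl' z hz) fun h => hzF (by rw [hlF']; exact ⟨hz, h⟩)
  have hnot : z - y ∉ vectorSpan ℝ F := by
    intro hmem
    have h3 : l (z - y) = 0 := apply_eq_zero_of_mem_vectorSpan (l := l.toLinearMap) e1 hmem
    rw [map_sub, e1 y hy] at h3
    linarith
  -- Only the component `t • (z - y)` of `x - y` matters: `l'` forces `t < 0`, and then `l` exceeds
  -- `a` at `x`.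
  have hsup : vectorSpan ℝ F ⊔ Submodule.span ℝ {z - y} = vectorSpan ℝ P := by
    apply Submodule.eq_of_le_of_finrank_eq
    · refine sup_le (vectorSpan_mono _ hsub) ?_
      rw [Submodule.span_singleton_le_iff_mem]
      exact vsub_mem_vectorSpan ℝ hz (hsub hy)
    · rw [Submodule.finrank_sup_span_singleton hnot, hdim]
  have hxy : x - y ∈ vectorSpan ℝ P := by
    rw [← direction_affineSpan]
    exact AffineSubspace.vsub_mem_direction hx (subset_affineSpan _ _ (hsub hy))
  rw [← hsup, Submodule.mem_sup] at hxy
  obtain ⟨s, hs, w, hw, hsw⟩ := hxy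
  obtain ⟨t, rfl⟩ := Submodule.mem_span_singleton.1 hw
  have h3 : l s = 0 := apply_eq_zero_of_mem_vectorSpan (l := l.toLinearMap) e1 hs
  have h4 : l' s = 0 := apply_eq_zero_of_mem_vectorSpan (l := l'.toLinearMap) e2 hs
  have h5 := congrArg l hsw
  have h6 := congrArg l' hsw
  simp only [map_add, map_smul, map_sub, smul_eq_mul, h3, h4, e1 y hy, e2 y hy, zero_add] at h5 h6
  have ht : t < 0 := by
    by_contra! hcon
    nlinarith [mul_nonneg hcon (sub_pos.2 h2).le]
  nlinarith [mul_pos_of_neg_of_neg ht (sub_neg.2 h1)]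

omit [FiniteDimensional ℝ E] in
theorem finite_isExposed (p : ι → E) :
    {F | IsExposed ℝ (convexHull ℝ (range p)) F}.Finite := by
  refine (finite_range fun J : Set ι => convexHull ℝ (p '' J)).subset ?_
  intro F hF
  rcases (isExposed_convexHull_range_iff p F).1 hF with rfl | ⟨l, a, -, -, rfl⟩
  · exact ⟨∅, by simp⟩
  · exact ⟨_, rfl⟩

end Facets

/-! ### The edges at a vertex on three facets -/

section SimpleVertex

variable {E : Type*} [NormedAddCommGroup E] [NormedSpace ℝ E] {P : Set E}

theorem IsFacet.exists_functional {F : Set E} (hF : IsFacet P F) :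
    ∃ (l : E →L[ℝ] ℝ) (a : ℝ), (∀ y ∈ P, l y ≤ a) ∧ F = {y ∈ P | l y = a} := by
  obtain ⟨h1, ⟨y, hy⟩, -⟩ := hF
  obtain ⟨l, rfl⟩ := h1 ⟨y, hy⟩
  refine ⟨l, l y, hy.2, ?_⟩
  ext x
  constructor
  · rintro ⟨h2, h3⟩
    exact ⟨h2, le_antisymm (hy.2 x h2) (h3 y hy.1)⟩
  · rintro ⟨h2, h3⟩
    exact ⟨h2, fun z hz => (hy.2 z hz).trans h3.ge⟩

theorem isExposed_sep {l : E →L[ℝ] ℝ} {a : ℝ} (h : ∀ y ∈ P, l y ≤ a) :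
    IsExposed ℝ P {y ∈ P | l y = a} := by
  rintro ⟨y, hy, hy'⟩
  refine ⟨l, ?_⟩
  ext x
  constructor
  · rintro ⟨h2, h3⟩
    exact ⟨h2, fun z hz => (h z hz).trans h3.ge⟩
  · rintro ⟨h2, h3⟩
    exact ⟨h2, le_antisymm (h x h2) (hy' ▸ h3 y hy)⟩

theorem IsPolytopeOfDim.exists_family {d : ℕ} (hP : IsPolytopeOfDim P d) :
    ∃ s : Finset E, P = convexHull ℝ (range ((↑) : s → E)) := by
  obtain ⟨⟨s, hs⟩, -, -⟩ := hP
  exact ⟨s, by rw [hs]; simp⟩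

theorem IsPolytopeOfDim.isCompact {d : ℕ} (hP : IsPolytopeOfDim P d) : IsCompact P := by
  obtain ⟨s, rfl⟩ := hP.exists_family
  exact (finite_range _).isCompact_convexHull ℝ

theorem IsPolytopeOfDim.finite_extremePoints {d : ℕ} (hP : IsPolytopeOfDim P d) :
    (extremePoints ℝ P).Finite := by
  obtain ⟨s, rfl⟩ := hP.exists_family
  exact (finite_range _).subset extremePoints_convexHull_subset

theorem IsPolytopeOfDim.finite_facets {d : ℕ} (hP : IsPolytopeOfDim P d) :
    {F | IsFacet P F}.Finite := by
  obtain ⟨s, rfl⟩ := hP.exists_family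
  exact (finite_isExposed _).subset fun F hF => hF.1

theorem IsPolytopeOfDim.exists_vertex_mem {d : ℕ} (hP : IsPolytopeOfDim P d) {F : Set E}
    (hF : IsFacet P F) : ∃ v ∈ extremePoints ℝ P, v ∈ F := by
  obtain ⟨v, hv⟩ := (hF.1.isCompact hP.isCompact).extremePoints_nonempty hF.2.1
  exact ⟨v, hF.1.isExtreme.extremePoints_subset_extremePoints hv, hv.1⟩

variable [FiniteDimensional ℝ E]

/-- The functionals of facets through `v` do not increase along `u`, and the finitely many other
facet inequalities stay strict for small `ε`. So the moved point is beyond no facet. -/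
theorem IsPolytopeOfDim.exists_add_smul_mem {d : ℕ} (hP : IsPolytopeOfDim P d) {v u : E}
    (hv : v ∈ P) (hu : u ∈ vectorSpan ℝ P)
    (h : ∀ F, IsFacet P F → v ∈ F → ∃ (l : E →L[ℝ] ℝ) (a : ℝ), (∀ y ∈ P, l y ≤ a) ∧
      F = {y ∈ P | l y = a} ∧ l u ≤ 0) : ∃ ε : ℝ, 0 < ε ∧ v + ε • u ∈ P := by
  have hspan : ∀ ε : ℝ, v + ε • u ∈ affineSpan ℝ P := by
    intro ε
    rw [add_comm]
    apply AffineSubspace.vadd_mem_of_mem_direction _ (subset_affineSpan ℝ P hv)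
    rw [direction_affineSpan]
    exact Submodule.smul_mem _ _ hu
  have hev : ∀ᶠ ε : ℝ in 𝓝[>] 0, ∀ F ∈ {F | IsFacet P F}, ¬ IsBeyond P F (v + ε • u) := by
    rw [eventually_all_finite hP.finite_facets]
    intro F hF
    by_cases hvF : v ∈ F
    · obtain ⟨l, a, h1, h2, h3⟩ := h F hF hvF
      filter_upwards [self_mem_nhdsWithin] with ε hε hb
      have h4 := hb.lt_apply hF (hspan ε) h1 h2
      have h5 : l v = a := by rw [h2] at hvF; exact hvF.2
      rw [map_add, map_smul, h5, smul_eq_mul] at h4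
      have h6 : (0 : ℝ) < ε := hε
      nlinarith
    · obtain ⟨l, a, h1, h2⟩ := hF.exists_functional
      have h3 : l v < a := lt_of_le_of_ne (h1 v hv) fun h' => hvF (by rw [h2]; exact ⟨hv, h'⟩)
      have hcont : Continuous fun ε : ℝ => l (v + ε • u) := by fun_prop
      have hlim : Tendsto (fun ε : ℝ => l (v + ε • u)) (𝓝[>] 0) (𝓝 (l v)) := by
        have := (hcont.tendsto 0).mono_left (nhdsWithin_le_nhds (s := Ioi 0))
        simpa using this
      filter_upwards [hlim.eventually (gt_mem_nhds h3)] with ε hε hb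
      exact lt_asymm hε (hb.lt_apply hF (hspan ε) h1 h2)
  obtain ⟨ε, hε, hε0⟩ := (hev.and self_mem_nhdsWithin).exists
  refine ⟨ε, hε0, ?_⟩
  by_contra hcon
  obtain ⟨s, hs⟩ := hP.exists_family
  have h1 := hspan ε
  rw [hs, affineSpan_convexHull] at h1
  rw [hs] at hcon
  obtain ⟨F, hF, hb⟩ := exists_isFacet_isBeyond _ h1 hcon
  rw [← hs] at hF hb
  exact hε F hF hb

/-- A vertex of a `3`-polytope that lies on exactly three facets: the facets `F i`, and the
neighbors `w k`, the one opposite to `F k`. -/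
theorem exists_neighbors (hP : IsPolytopeOfDim P 3) {v : E} (hv : v ∈ extremePoints ℝ P)
    (h3 : {F : Set E | IsFacet P F ∧ v ∈ F}.ncard = 3) :
    ∃ (F : Fin 3 → Set E) (w : Fin 3 → E), Function.Injective F ∧
      (∀ G, IsFacet P G ∧ v ∈ G ↔ ∃ i, G = F i) ∧
      (∀ k, w k ∈ extremePoints ℝ P ∧ w k ≠ v) ∧ (∀ i k, i ≠ k → w k ∈ F i) ∧
      (∀ i j, i ≠ j → ∃ e, IsFaceOfDim P e 1 ∧ e ⊆ F i ∧ e ⊆ F j) ∧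
      ∀ x ∈ P, ∃ c : Fin 3 → ℝ, (∀ k, 0 ≤ c k) ∧ (∀ k, x ∈ F k → c k = 0) ∧
        x - v = ∑ k, c k • (w k - v) := by
  have hfin : {F : Set E | IsFacet P F ∧ v ∈ F}.Finite := finite_of_ncard_ne_zero (by omega)
  have hcard : Nat.card {F : Set E | IsFacet P F ∧ v ∈ F} = 3 := h3
  have : Finite {F : Set E | IsFacet P F ∧ v ∈ F} := hfin
  let en := (Finite.equivFinOfCardEq hcard).symm
  have hF : ∀ i, IsFacet P (en i).1 ∧ v ∈ (en i).1 := fun i => (en i).2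
  have hFmem : ∀ G, IsFacet P G ∧ v ∈ G ↔ ∃ i, G = (en i).1 := by
    intro G
    constructor
    · intro h
      exact ⟨en.symm ⟨G, h⟩, by simp⟩
    · rintro ⟨i, rfl⟩
      exact hF i
  have hvP : v ∈ P := hv.1
  choose l a hl hlF using fun i => (hF i).1.exists_functional
  have hlv : ∀ i, l i v = a i := fun i => by
    have := (hF i).2
    rw [hlF i] at this
    exact this.2
  have hsub : ∀ {x}, x ∈ P → x - v ∈ vectorSpan ℝ P := fun hx => vsub_mem_vectorSpan ℝ hx hvP
  have hstep : ∀ u ∈ vectorSpan ℝ P, (∀ i, l i u ≤ 0) → ∃ ε : ℝ, 0 < ε ∧ v + ε • u ∈ P := by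
    intro u hu h
    refine hP.exists_add_smul_mem hvP hu fun G hG hvG => ?_
    obtain ⟨i, rfl⟩ := (hFmem G).1 ⟨hG, hvG⟩
    exact ⟨l i, a i, hl i, hlF i, h i⟩
  -- A direction killed by all three functionals could be followed both ways inside `P`, against
  -- extremality of `v`. So the `l i` are coordinates on the three-dimensional direction space.
  have hzero : ∀ u ∈ vectorSpan ℝ P, (∀ i, l i u = 0) → u = 0 := by
    intro u hu h
    obtain ⟨ε, hε, h1⟩ := hstep u hu fun i => (h i).le
    obtain ⟨δ, hδ, h2⟩ := hstep (-u) (Submodule.neg_mem _ hu) fun i => by simp [h i]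
    have h4 : v + ε • u = v := by
      refine hv.2 h1 h2 ⟨δ / (ε + δ), ε / (ε + δ), by positivity, by positivity,
        by field_simp; ring, ?_⟩
      match_scalars <;> field_simp <;> ring
    have h5 : ε • u = 0 := by simpa using h4
    exact (smul_eq_zero.1 h5).resolve_left hε.ne'
  let T : vectorSpan ℝ P →ₗ[ℝ] (Fin 3 → ℝ) :=
    LinearMap.pi fun i => (l i).toLinearMap ∘ₗ (vectorSpan ℝ P).subtype
  have hTinj : Function.Injective T := by
    rw [injective_iff_map_eq_zero]
    intro u hu
    exact Subtype.ext (hzero u u.2 fun i => congrFun hu i)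
  have hTsurj : Function.Surjective T :=
    (LinearMap.injective_iff_surjective_of_finrank_eq_finrank (by rw [hP.2.2]; simp)).1 hTinj
  have hbasis : ∀ k, ∃ e ∈ vectorSpan ℝ P, ∀ i, l i e = if i = k then -1 else 0 := by
    intro k
    obtain ⟨e, he⟩ := hTsurj fun i => if i = k then -1 else 0
    exact ⟨e, e.2, fun i => congrFun he i⟩
  choose e he hle using hbasis
  have hexpand : ∀ x ∈ P, x - v = ∑ k, (a k - l k x) • e k := by
    intro x hx
    rw [← sub_eq_zero]
    refine hzero _ (Submodule.sub_mem _ (hsub hx)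
      (Submodule.sum_mem _ fun k _ => Submodule.smul_mem _ _ (he k))) fun i => ?_
    simp [map_sum, hle, hlv]
  -- A sum of two upper bounds is attained only when both are, so this is the intersection of the
  -- two facets other than the `k`-th.
  let edge : Fin 3 → Set E := fun k =>
    {y ∈ P | (∑ i ∈ Finset.univ.erase k, l i) y = ∑ i ∈ Finset.univ.erase k, a i}
  have hedge_exp : ∀ k, IsExposed ℝ P (edge k) := fun k => isExposed_sep fun y hy => by
    rw [sum_apply]
    exact Finset.sum_le_sum fun i _ => hl i y hy
  have hedge : ∀ k y, y ∈ edge k ↔ y ∈ P ∧ ∀ i, i ≠ k → l i y = a i := by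
    intro k y
    refine and_congr_right fun hy => ?_
    rw [sum_apply, Finset.sum_eq_sum_iff_of_le fun i _ => hl i y hy]
    simp
  have hedgeF : ∀ i k, i ≠ k → edge k ⊆ (en i).1 := by
    intro i k hik y hy
    rw [hlF i]
    exact ⟨((hedge k y).1 hy).1, ((hedge k y).1 hy).2 i hik⟩
  have hedge_sub : ∀ k, ∀ y ∈ edge k, y - v = (a k - l k y) • e k := by
    intro k y hy
    obtain ⟨h1, h2⟩ := (hedge k y).1 hy
    rw [hexpand y h1, Finset.sum_eq_single k]
    · intro i _ hi
      rw [h2 i hi, sub_self, zero_smul]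
    · simp
  have hvedge : ∀ k, v ∈ edge k := fun k => (hedge k v).2 ⟨hvP, fun i _ => hlv i⟩
  -- On `edge k` only the coordinate `l k` varies, and it is largest at `v`; its minimizer is the
  -- far end of the edge.
  have hmin : ∀ k, ∃ w, w ∈ edge k ∧ ∀ y ∈ edge k, l k w ≤ l k y := fun k =>
    ((hedge_exp k).isCompact hP.isCompact).exists_isMinOn ⟨v, hvedge k⟩
      (l k).continuous.continuousOn
  choose w hw hwmin using hmin
  have hwlt : ∀ k, l k (w k) < a k := by
    intro k
    obtain ⟨ε, hε, h1⟩ := hstep (e k) (he k) fun i => by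
      rw [hle]
      split_ifs <;> norm_num
    have h2 : v + ε • e k ∈ edge k := (hedge k _).2 ⟨h1, fun i hi => by simp [hle, hi, hlv]⟩
    have h4 := hwmin k _ h2
    rw [map_add, map_smul, hle, if_pos rfl, hlv, smul_eq_mul] at h4
    linarith
  have hwext : ∀ k, w k ∈ extremePoints ℝ P := by
    intro k
    have h1 : ∀ y ∈ edge k, (-l k) y ≤ -(l k (w k)) := fun y hy => neg_le_neg (hwmin k y hy)
    have h2 := isExposed_sep h1
    have h4 : {y ∈ edge k | (-l k) y = -(l k (w k))} = {w k} := by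
      ext y
      constructor
      · rintro ⟨h5, h6⟩
        have h7 : l k y = l k (w k) := neg_injective h6
        have h8 := hedge_sub k y h5
        rw [h7, ← hedge_sub k _ (hw k)] at h8
        exact sub_left_injective h8
      · rintro rfl
        exact ⟨hw k, rfl⟩
    rw [h4] at h2
    exact isExtreme_singleton.1 ((hedge_exp k).isExtreme.trans h2.isExtreme)
  have hwne : ∀ k, w k ≠ v := fun k h => by
    have := hwlt k
    rw [h, hlv] at this
    exact lt_irrefl _ this
  refine ⟨fun i => (en i).1, w, fun i j h => en.injective (Subtype.ext h), hFmem,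
    fun k => ⟨hwext k, hwne k⟩, fun i k hik => hedgeF i k hik (hw k), fun i j hij => ?_,
    fun x hx => ?_⟩
  · obtain ⟨k, hik, hjk⟩ : ∃ k : Fin 3, i ≠ k ∧ j ≠ k := by
      revert i j
      decide
    refine ⟨edge k, ⟨hedge_exp k, ⟨v, hvedge k⟩, ?_⟩, hedgeF i k hik, hedgeF j k hjk⟩
    have h1 : vectorSpan ℝ (edge k) = Submodule.span ℝ {w k - v} := by
      apply le_antisymm
      · refine vectorSpan_le_of_sub_mem v _ fun y hy => ?_
        rw [Submodule.mem_span_singleton]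
        refine ⟨(a k - l k y) / (a k - l k (w k)), ?_⟩
        have h2 : a k - l k (w k) ≠ 0 := (sub_pos.2 (hwlt k)).ne'
        rw [hedge_sub k _ (hw k), hedge_sub k y hy, smul_smul, div_mul_cancel₀ _ h2]
      · rw [Submodule.span_singleton_le_iff_mem]
        exact vsub_mem_vectorSpan ℝ (hw k) (hvedge k)
    rw [h1, finrank_span_singleton (sub_ne_zero.2 (hwne k))]
  · refine ⟨fun k => (a k - l k x) / (a k - l k (w k)), fun k => div_nonneg
      (sub_nonneg.2 (hl k x hx)) (sub_pos.2 (hwlt k)).le, fun k hk => ?_, ?_⟩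
    · have hk' : x ∈ (en k).1 := hk
      rw [hlF k] at hk'
      change (a k - l k x) / (a k - l k (w k)) = 0
      rw [hk'.2, sub_self, zero_div]
    · rw [hexpand x hx]
      refine Finset.sum_congr rfl fun k _ => ?_
      have h2 : a k - l k (w k) ≠ 0 := (sub_pos.2 (hwlt k)).ne'
      rw [hedge_sub k _ (hw k), smul_smul, div_mul_cancel₀ _ h2]

end SimpleVertex

/-! ### Colored facets, Euler's relation and the dependencies of the incidence vectors -/

section Coloring

variable {E : Type*} [NormedAddCommGroup E] [NormedSpace ℝ E] [FiniteDimensional ℝ E] {P : Set E}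
  {c : Facet P → Fin 3}

/-- The facets at each vertex, indexed by their colors, and the neighbors of the vertex, the one
along the edge off the facet of color `k` being `nb v k`. -/
structure VertexFigures (P : Set E) (c : Facet P → Fin 3) where
  fac : Vertex P → Fin 3 → Facet P
  nb : Vertex P → Fin 3 → Vertex P
  color_fac : ∀ v i, c (fac v i) = i
  mem_iff : ∀ (v : Vertex P) (f : Facet P), v.1 ∈ f.1 ↔ f = fac v (c f)
  nb_ne : ∀ v k, nb v k ≠ v
  nb_mem : ∀ v i k, i ≠ k → (nb v k).1 ∈ (fac v i).1
  cone : ∀ (v : Vertex P), ∀ x ∈ P, ∃ a : Fin 3 → ℝ, (∀ k, 0 ≤ a k) ∧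
    (∀ k, x ∈ (fac v k).1 → a k = 0) ∧ x - v.1 = ∑ k, a k • ((nb v k).1 - v.1)

/-- Any two of the three facets at `v` share an edge, so all three colors occur once and can serve
as indices. -/
theorem IsThreeColoring.exists_figure (hP : IsSimpleThreePolytope P) (hc : IsThreeColoring P c)
    (v : Vertex P) : ∃ (F : Fin 3 → Facet P) (w : Fin 3 → Vertex P),
      (∀ i, c (F i) = i) ∧ (∀ f : Facet P, v.1 ∈ f.1 ↔ f = F (c f)) ∧ (∀ k, w k ≠ v) ∧
      (∀ i k, i ≠ k → (w k).1 ∈ (F i).1) ∧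
      ∀ x ∈ P, ∃ a : Fin 3 → ℝ, (∀ k, 0 ≤ a k) ∧ (∀ k, x ∈ (F k).1 → a k = 0) ∧
        x - v.1 = ∑ k, a k • ((w k).1 - v.1) := by
  obtain ⟨F, w, hinj, hmem, hw, hwF, hedge, hcone⟩ := exists_neighbors hP.1 v.2 (hP.2 v.1 v.2)
  have hF : ∀ i, IsFacet P (F i) ∧ v.1 ∈ F i := fun i => (hmem _).2 ⟨i, rfl⟩
  let F' : Fin 3 → Facet P := fun i => ⟨F i, (hF i).1⟩
  have hcol : Function.Injective fun i => c (F' i) := by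
    intro i j hij
    by_contra hne
    exact hc (F' i) (F' j) (fun h => hne (hinj (congrArg Subtype.val h))) (hedge i j hne) hij
  let σ : Fin 3 ≃ Fin 3 := Equiv.ofBijective _ (Finite.injective_iff_bijective.1 hcol)
  have hσ : ∀ i, c (F' (σ.symm i)) = i := fun i => σ.apply_symm_apply i
  refine ⟨fun i => F' (σ.symm i), fun k => ⟨w (σ.symm k), (hw _).1⟩, hσ, fun f => ?_,
    fun k h => (hw (σ.symm k)).2 (congrArg Subtype.val h),
    fun i k hik => hwF _ _ fun h => hik (σ.symm.injective h), fun x hx => ?_⟩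
  · constructor
    · intro h
      obtain ⟨i, hi⟩ := (hmem f.1).1 ⟨f.2, h⟩
      have hi' : f = F' i := Subtype.ext hi
      have h1 : σ.symm (c f) = i := by
        rw [hi']
        exact σ.symm_apply_apply i
      change f = F' (σ.symm (c f))
      rw [h1, hi']
    · intro h
      rw [h]
      exact (hF _).2
  · obtain ⟨a, h1, h2, h3⟩ := hcone x hx
    refine ⟨fun k => a (σ.symm k), fun k => h1 _, fun k hk => h2 _ hk, ?_⟩
    rw [h3]
    exact (Equiv.sum_comp σ.symm fun k => a k • (w k - v.1)).symm

theorem IsThreeColoring.nonempty_vertexFigures (hP : IsSimpleThreePolytope P)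
    (hc : IsThreeColoring P c) : Nonempty (VertexFigures P c) := by
  choose F w h1 h2 h3 h4 h5 using IsThreeColoring.exists_figure hP hc
  exact ⟨⟨F, w, h1, h2, h3, h4, h5⟩⟩

namespace VertexFigures

omit [FiniteDimensional ℝ E]

variable (V : VertexFigures P c)

include V in
theorem fac_mem (v : Vertex P) (i : Fin 3) : v.1 ∈ (V.fac v i).1 := by
  rw [V.mem_iff, V.color_fac]

include V in
theorem fac_nb (v : Vertex P) {i k : Fin 3} (h : i ≠ k) : V.fac (V.nb v k) i = V.fac v i := by
  have := (V.mem_iff _ _).1 (V.nb_mem v i k h)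
  rw [V.color_fac] at this
  exact this.symm

theorem sum_ite_mem [Fintype (Facet P)] {M : Type*} [AddCommMonoid M] (v : Vertex P)
    (g : Facet P → M) [∀ f : Facet P, Decidable (v.1 ∈ f.1)] :
    ∑ f, (if v.1 ∈ f.1 then g f else 0) = ∑ i, g (V.fac v i) := by
  classical
  rw [← Finset.sum_filter]
  symm
  refine Finset.sum_bij' (fun i _ => V.fac v i) (fun f _ => c f) ?_ ?_ ?_ ?_ ?_
  · intro i _
    simp [V.fac_mem v i]
  · intro f _
    simp
  · intro i _
    exact V.color_fac v i
  · intro f hf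
    exact ((V.mem_iff v f).1 (by simpa using hf)).symm
  · intro i _
    rfl

theorem sum_mul_incVec [Fintype (Facet P)] (v : Vertex P) (μ : Facet P → ℝ) :
    (∑ f, μ f • incVec P f) v = ∑ i, μ (V.fac v i) := by
  classical
  rw [← V.sum_ite_mem v μ, Finset.sum_apply]
  refine Finset.sum_congr rfl fun f _ => ?_
  simp [incVec, Set.indicator_apply]

/-- `P` lies in the cone at `v` spanned by the edges, so a local maximum is global. -/
theorem isMax_of_nb (φ : E →ₗ[ℝ] ℝ) (v : Vertex P) (h : ∀ k, φ (V.nb v k).1 ≤ φ v.1) {x : E}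
    (hx : x ∈ P) : φ x ≤ φ v.1 := by
  obtain ⟨a, h1, -, h3⟩ := V.cone v x hx
  have := congrArg φ h3
  simp only [map_sub, map_sum, map_smul, smul_eq_mul] at this
  have h4 : ∑ k, a k * (φ (V.nb v k).1 - φ v.1) ≤ 0 :=
    Finset.sum_nonpos fun k _ => mul_nonpos_of_nonneg_of_nonpos (h1 k) (sub_nonpos.2 (h k))
  linarith

theorem isMax_fac_of_nb (φ : E →ₗ[ℝ] ℝ) (v : Vertex P) (i : Fin 3)
    (h : ∀ k, k ≠ i → φ (V.nb v k).1 ≤ φ v.1) {x : E} (hx : x ∈ P) (hxi : x ∈ (V.fac v i).1) :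
    φ x ≤ φ v.1 := by
  obtain ⟨a, h1, h2, h3⟩ := V.cone v x hx
  have := congrArg φ h3
  simp only [map_sub, map_sum, map_smul, smul_eq_mul] at this
  have h4 : ∑ k, a k * (φ (V.nb v k).1 - φ v.1) ≤ 0 := by
    refine Finset.sum_nonpos fun k _ => ?_
    by_cases hk : k = i
    · rw [hk, h2 i hxi, zero_mul]
    · exact mul_nonpos_of_nonneg_of_nonpos (h1 k) (sub_nonpos.2 (h k hk))
  linarith

end VertexFigures

omit [FiniteDimensional ℝ E] in
theorem exists_generic_functional (P : Set E) [Finite (Vertex P)] :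
    ∃ φ : E →ₗ[ℝ] ℝ, Function.Injective fun v : Vertex P => φ v.1 := by
  obtain ⟨φ, hφ⟩ := Module.exists_dual_forall_apply_ne_zero (K := ℝ)
    (fun q : {q : Vertex P × Vertex P // q.1 ≠ q.2} => q.1.1.1 - q.1.2.1)
    (fun q => sub_ne_zero.2 fun h => q.2 (Subtype.ext h))
  refine ⟨φ, fun v w h => ?_⟩
  by_contra hne
  exact hφ ⟨(v, w), hne⟩ (by simpa [sub_eq_zero] using h)

namespace VertexFigures

variable (V : VertexFigures P c)

-- Consider the highest vertex whose values differ from those at the top vertex. It has a higher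
-- neighbor, which carries the right values and shares two of its facets; the vanishing sum
-- determines the third value.
omit [FiniteDimensional ℝ E] in
include V in
theorem exists_eq_comp_color [Finite (Vertex P)] [Nonempty (Vertex P)]
    (hf : ∀ f : Facet P, ∃ v : Vertex P, v.1 ∈ f.1) (μ : Facet P → ℝ)
    (hμ : ∀ v, ∑ i, μ (V.fac v i) = 0) :
    ∃ α : Fin 3 → ℝ, ∑ i, α i = 0 ∧ ∀ f, μ f = α (c f) := by
  obtain ⟨φ, hφ⟩ := exists_generic_functional P
  obtain ⟨v₀, hv₀⟩ := Finite.exists_max fun v : Vertex P => φ v.1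
  refine ⟨fun i => μ (V.fac v₀ i), hμ v₀, ?_⟩
  have key : ∀ v i, μ (V.fac v i) = μ (V.fac v₀ i) := by
    by_contra! hcon
    obtain ⟨v, ⟨i, hi⟩, hmax⟩ := Set.exists_max_image
      {v | ∃ i, μ (V.fac v i) ≠ μ (V.fac v₀ i)} (fun v : Vertex P => φ v.1) (toFinite _) hcon
    have hv : ∃ k, φ v.1 < φ (V.nb v k).1 := by
      by_contra! h
      have h1 := V.isMax_of_nb φ v h v₀.2.1
      have h2 : v = v₀ := hφ (le_antisymm (hv₀ v) h1)
      rw [h2] at hi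
      exact hi rfl
    obtain ⟨k, hk⟩ := hv
    have h3 : ∀ j, μ (V.fac (V.nb v k) j) = μ (V.fac v₀ j) := by
      by_contra! h
      exact absurd (hmax _ h) (not_le.2 hk)
    have h4 : ∀ j, j ≠ k → μ (V.fac v j) = μ (V.fac v₀ j) := fun j hj => by
      rw [← h3, V.fac_nb v hj]
    have h5 : μ (V.fac v k) = μ (V.fac v₀ k) := by
      have h6 := (hμ v).trans (hμ v₀).symm
      rw [← Finset.add_sum_erase _ _ (Finset.mem_univ k),
        ← Finset.add_sum_erase _ (fun i => μ (V.fac v₀ i)) (Finset.mem_univ k),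
        Finset.sum_congr rfl fun j hj => h4 j (Finset.ne_of_mem_erase hj)] at h6
      exact add_right_cancel h6
    by_cases hik : i = k
    · exact hi (hik ▸ h5)
    · exact hi (h4 i hik)
  intro f
  obtain ⟨v, hv⟩ := hf f
  have := (V.mem_iff v f).1 hv
  conv_lhs => rw [this]
  exact key v _

open Classical in
omit [FiniteDimensional ℝ E] in
/-- Each facet is counted at its highest vertex. -/
theorem card_facet_eq_sum [Fintype (Facet P)] [Fintype (Vertex P)]
    (hf : ∀ f : Facet P, ∃ v : Vertex P, v.1 ∈ f.1) (φ : E →ₗ[ℝ] ℝ)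
    (hφ : Function.Injective fun v : Vertex P => φ v.1) :
    Fintype.card (Facet P) =
      ∑ v, ∑ i, if ∀ k, k ≠ i → φ (V.nb v k).1 < φ v.1 then 1 else 0 := by
  let M : Facet P → Vertex P → Prop := fun f v => ∀ x : Vertex P, x.1 ∈ f.1 → φ x.1 ≤ φ v.1
  have h1 : ∀ f : Facet P,
      ∑ v : Vertex P, (if v.1 ∈ f.1 then (if M f v then 1 else 0) else 0) = 1 := by
    intro f
    obtain ⟨v, hv, hmax⟩ := Set.exists_max_image {v : Vertex P | v.1 ∈ f.1} (fun v => φ v.1)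
      (toFinite _) (hf f)
    rw [Finset.sum_eq_single v]
    · exact (if_pos hv).trans (if_pos hmax)
    · intro w _ hw
      split_ifs with h h'
      · exact absurd (hφ (le_antisymm (hmax w h) (h' v hv))) hw
      · rfl
      · rfl
    · simp
  have h2 : Fintype.card (Facet P) =
      ∑ f : Facet P, ∑ v : Vertex P, (if v.1 ∈ f.1 then (if M f v then 1 else 0) else 0) := by
    simp only [h1]
    simp
  rw [h2, Finset.sum_comm]
  refine Finset.sum_congr rfl fun v _ => ?_
  rw [V.sum_ite_mem v fun f => if M f v then 1 else 0]
  refine Finset.sum_congr rfl fun i _ => ?_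
  congr 1
  -- A vertex is the highest of one of its facets iff its two neighbors within that facet are lower.
  refine propext ⟨fun h k hk => ?_, fun h x hx => ?_⟩
  · refine lt_of_le_of_ne (h _ (V.nb_mem v i k hk.symm)) fun h' => V.nb_ne v k (hφ h')
  · exact V.isMax_fac_of_nb φ v i (fun k hk => (h k hk).le) x.2.1 hx

open Classical in
omit [FiniteDimensional ℝ E] in
theorem sum_isMax_eq_one [Fintype (Vertex P)] [Nonempty (Vertex P)] (φ : E →ₗ[ℝ] ℝ)
    (hφ : Function.Injective fun v : Vertex P => φ v.1) :
    ∑ v, (if ∀ k, φ (V.nb v k).1 < φ v.1 then 1 else 0) = 1 := by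
  obtain ⟨v₀, hv₀⟩ := Finite.exists_max fun v : Vertex P => φ v.1
  rw [Finset.sum_eq_single v₀]
  · rw [if_pos]
    intro k
    exact lt_of_le_of_ne (hv₀ _) fun h => V.nb_ne v₀ k (hφ h)
  · intro v _ hv
    rw [if_neg]
    intro h
    exact hv (hφ (le_antisymm (hv₀ v) (V.isMax_of_nb φ v (fun k => (h k).le) v₀.2.1)))
  · simp

omit [FiniteDimensional ℝ E] in
include V in
/-- Euler's relation for a simple polytope of dimension three. -/
theorem two_mul_card_facet [Fintype (Facet P)] [Fintype (Vertex P)] [Nonempty (Vertex P)]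
    (hf : ∀ f : Facet P, ∃ v : Vertex P, v.1 ∈ f.1) :
    2 * Fintype.card (Facet P) = Fintype.card (Vertex P) + 4 := by
  classical
  obtain ⟨φ, hφ⟩ := exists_generic_functional P
  have hφ' : Function.Injective fun v : Vertex P => (-φ) v.1 := fun v w h =>
    hφ (neg_injective h)
  have e1 := V.card_facet_eq_sum hf φ hφ
  have e2 := V.card_facet_eq_sum hf (-φ) hφ'
  have e3 := V.sum_isMax_eq_one φ hφ
  have e4 := V.sum_isMax_eq_one (-φ) hφ'
  have hneg : ∀ v k, (-φ) (V.nb v k).1 < (-φ) v.1 ↔ ¬ φ (V.nb v k).1 < φ v.1 := by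
    intro v k
    rw [LinearMap.neg_apply, LinearMap.neg_apply, neg_lt_neg_iff, not_lt]
    exact ⟨le_of_lt, fun h => lt_of_le_of_ne h fun h' => V.nb_ne v k (hφ h'.symm)⟩
  simp only [hneg] at e2 e4
  -- Counting facets at their highest and at their lowest vertices, the top and the bottom vertex
  -- contribute `3` each and every other vertex `1`, whence the summand `4`.
  have hloc : ∀ s : Fin 3 → Bool, (∑ i, if ∀ k, k ≠ i → s k = true then 1 else 0) +
      (∑ i, if ∀ k, k ≠ i → ¬ s k = true then 1 else 0) =
      1 + 2 * (if ∀ k, s k = true then 1 else 0) +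
        2 * (if ∀ k, ¬ s k = true then 1 else 0) := by decide
  have hv : ∀ v, (∑ i, if ∀ k, k ≠ i → φ (V.nb v k).1 < φ v.1 then 1 else 0) +
      (∑ i, if ∀ k, k ≠ i → ¬ φ (V.nb v k).1 < φ v.1 then 1 else 0) =
      1 + 2 * (if ∀ k, φ (V.nb v k).1 < φ v.1 then 1 else 0) +
        2 * (if ∀ k, ¬ φ (V.nb v k).1 < φ v.1 then 1 else 0) := by
    intro v
    have := hloc fun k => decide (φ (V.nb v k).1 < φ v.1)
    simpa only [decide_eq_true_eq] using this
  have hsum : 2 * Fintype.card (Facet P) = ∑ v : Vertex P, (1 +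
      2 * (if ∀ k, φ (V.nb v k).1 < φ v.1 then 1 else 0) +
        2 * (if ∀ k, ¬ φ (V.nb v k).1 < φ v.1 then 1 else 0)) := by
    simp only [← hv]
    rw [Finset.sum_add_distrib, two_mul]
    congr 1
  rw [hsum, Finset.sum_add_distrib, Finset.sum_add_distrib, ← Finset.mul_sum, ← Finset.mul_sum,
    e3, e4]
  simp

end VertexFigures

omit [FiniteDimensional ℝ E] in
theorem sum_comp_color [Fintype (Facet P)] (c : Facet P → Fin 3) (g : Fin 3 → ℝ) :
    ∑ f, g (c f) = ∑ i, (numColor P c i : ℝ) * g i := by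
  classical
  rw [← Finset.sum_fiberwise Finset.univ c]
  refine Finset.sum_congr rfl fun i _ => ?_
  rw [Finset.sum_congr rfl (g := fun _ => g i) (fun f hf => by rw [(Finset.mem_filter.1 hf).2]),
    Finset.sum_const, nsmul_eq_mul]
  congr 2
  unfold numColor
  rw [← Set.ncard_coe_finset]
  congr 1
  ext f
  simp

theorem hasDependency_incVec [Fintype (Facet P)] [Fintype (Vertex P)]
    (hP : IsSimpleThreePolytope P) (hc : IsThreeColoring P c)
    (h₃₂ : numColor P c 2 = numColor P c 1) (h₂₁ : numColor P c 0 < numColor P c 1) :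
    HasDependency (incVec P) (fun f => (![0, 1, -1] : Fin 3 → ℝ) (c f)) := by
  obtain ⟨V⟩ := hc.nonempty_vertexFigures hP
  have hf : ∀ f : Facet P, ∃ v : Vertex P, v.1 ∈ f.1 := by
    intro f
    obtain ⟨v, hv, hvf⟩ := hP.1.exists_vertex_mem f.2
    exact ⟨⟨v, hv⟩, hvf⟩
  have hne : Nonempty (Vertex P) :=
    (hP.1.isCompact.extremePoints_nonempty hP.1.2.1).to_subtype
  intro μ
  have hcoord : ∑ f, μ f • incVec P f = 0 ↔ ∀ v, ∑ i, μ (V.fac v i) = 0 := by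
    rw [funext_iff]
    simp only [V.sum_mul_incVec, Pi.zero_apply]
  rw [hcoord]
  constructor
  · rintro ⟨h1, h2⟩
    obtain ⟨α, hα, hμ⟩ := V.exists_eq_comp_color hf μ h2
    simp only [hμ, sum_comp_color, Fin.sum_univ_three, h₃₂] at h1 hα
    -- Eliminating `α 1 + α 2` between the vertex relation and the total sum leaves `α 0` times the
    -- difference of two unequal class sizes.
    have h0 : α 0 = 0 := by
      have h3 : ((numColor P c 0 : ℝ) - numColor P c 1) * α 0 = 0 := by
        linear_combination h1 - (numColor P c 1 : ℝ) * hα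
      refine (mul_eq_zero.1 h3).resolve_left (sub_ne_zero.2 ?_)
      exact_mod_cast h₂₁.ne
    refine ⟨α 1, funext fun f => ?_⟩
    rw [hμ, Pi.smul_apply, smul_eq_mul]
    generalize c f = i
    fin_cases i
    · simp [h0]
    · simp
    · simp
      linarith
  · rintro ⟨t, rfl⟩
    constructor
    · simp only [Pi.smul_apply, smul_eq_mul, ← Finset.mul_sum]
      rw [sum_comp_color]
      simp [Fin.sum_univ_three, h₃₂]
    · intro v
      simp [Fin.sum_univ_three, V.color_fac]

end Coloring

/-! ### Gale diagrams on the line and failure to be a simplex -/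

section Gale

variable {E : Type*} [NormedAddCommGroup E] [NormedSpace ℝ E] {ι : Type*} [Fintype ι]
  {p : ι → E} {lam : ι → ℝ}

theorem HasDependency.mem_affineDependencies_iff (hp : HasDependency p lam) (μ : ι →₀ ℝ) :
    μ ∈ affineDependencies p ↔ ∃ t : ℝ, (μ : ι → ℝ) = t • lam := by
  rw [← hp, affineDependencies, LinearMap.mem_ker, Finsupp.linearCombination_apply,
    Finsupp.sum_fintype _ _ (by simp), Prod.ext_iff]
  simp [Prod.fst_sum, Prod.snd_sum]

theorem norm_euclidean_one (x : EuclideanSpace ℝ (Fin 1)) : ‖x‖ = |x 0| := by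
  rw [EuclideanSpace.norm_eq]
  simp [Real.sqrt_sq_eq_abs]

/-- A basis of the line of dependencies is `t • lam` with `t ≠ 0`; after normalization only the sign
of `t` survives. -/
theorem HasDependency.isGaleDiagram_iff (hp : HasDependency p lam) (hlam : ∃ i, lam i ≠ 0)
    (g : ι → EuclideanSpace ℝ (Fin 1)) :
    IsGaleDiagram p g ↔ (∀ i, g i 0 = |lam i|⁻¹ * lam i) ∨ ∀ i, g i 0 = -(|lam i|⁻¹ * lam i) := by
  classical
  constructor
  · rintro ⟨g', ⟨b, hb⟩, hg⟩
    obtain ⟨t, ht⟩ := (hp.mem_affineDependencies_iff _).1 (b 0).2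
    have ht0 : t ≠ 0 := by
      rintro rfl
      apply b.ne_zero 0
      ext i
      simpa using congrFun ht i
    have hval : ∀ i, g i 0 = (|t|⁻¹ * t) * (|lam i|⁻¹ * lam i) := by
      intro i
      have h1 : g' i 0 = t * lam i := by
        rw [hb, ht, Pi.smul_apply, smul_eq_mul]
      rw [hg, PiLp.smul_apply, norm_euclidean_one, h1, smul_eq_mul, abs_mul, mul_inv]
      ring
    rcases lt_or_gt_of_ne ht0 with h | h
    · right
      intro i
      rw [hval, abs_of_neg h, inv_neg, neg_mul, inv_mul_cancel₀ ht0, neg_one_mul]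
    · left
      intro i
      rw [hval, abs_of_pos h, inv_mul_cancel₀ ht0, one_mul]
  · intro h
    obtain ⟨s, hs, hg⟩ : ∃ s : ℝ, |s| = 1 ∧ ∀ i, g i 0 = s * (|lam i|⁻¹ * lam i) := by
      rcases h with h | h
      · exact ⟨1, by simp, fun i => by rw [h, one_mul]⟩
      · exact ⟨-1, by simp, fun i => by rw [h, neg_one_mul]⟩
    have hs0 : s ≠ 0 := by
      rintro rfl
      simp at hs
    obtain ⟨L, hLval⟩ : ∃ L : affineDependencies p, ∀ i, L.1 i = s * lam i :=
      ⟨⟨Finsupp.equivFunOnFinite.symm (s • lam),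
        (hp.mem_affineDependencies_iff _).2 ⟨s, rfl⟩⟩, fun i => rfl⟩
    have hspan : ⊤ ≤ Submodule.span ℝ (range fun _ : Fin 1 => L) := by
      rintro ⟨μ, hμ⟩ -
      obtain ⟨t, ht⟩ := (hp.mem_affineDependencies_iff _).1 hμ
      rw [range_const, Submodule.mem_span_singleton]
      refine ⟨t / s, Subtype.ext (Finsupp.ext fun i => ?_)⟩
      have h1 := congrFun ht i
      rw [Submodule.coe_smul, Finsupp.smul_apply, hLval, h1, Pi.smul_apply, smul_eq_mul,
        smul_eq_mul, ← mul_assoc, div_mul_cancel₀ _ hs0]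
    have hind : LinearIndependent ℝ (fun _ : Fin 1 => L) := by
      rw [Fintype.linearIndependent_iffₛ]
      intro a a' ha k
      obtain ⟨i, hi⟩ := hlam
      rw [Fin.sum_univ_one, Fin.sum_univ_one] at ha
      have h1 := DFunLike.congr_fun (congrArg Subtype.val ha) i
      rw [Submodule.coe_smul, Submodule.coe_smul, Finsupp.smul_apply, Finsupp.smul_apply,
        hLval] at h1
      rw [Subsingleton.elim k 0]
      exact mul_right_cancel₀ (mul_ne_zero hs0 hi) h1
    refine ⟨fun i => WithLp.toLp 2 fun _ => s * lam i, ⟨Module.Basis.mk hind hspan, ?_⟩, ?_⟩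
    · intro i j
      rw [Module.Basis.mk_apply]
      exact (hLval i).symm
    · intro i
      ext j
      rw [Subsingleton.elim j 0, hg, PiLp.smul_apply, norm_euclidean_one]
      change _ = |s * lam i|⁻¹ * (s * lam i)
      rw [abs_mul, hs, one_mul]
      ring

/-- The vertices of a simplex are affinely independent, while here they are the points `p i`, which
satisfy a nontrivial dependency. -/
theorem HasDependency.not_isSimplex [FiniteDimensional ℝ E] (hp : HasDependency p lam)
    (hb : ∀ i, Balanced lam {i}) (hlam : ∃ i, lam i ≠ 0) :
    ¬ IsSimplex (convexHull ℝ (range p)) := by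
  rintro ⟨s, hs, hs'⟩
  have h1 : extremePoints ℝ (convexHull ℝ (s : Set E)) = s := by
    have := (hasDependency_zero_iff.2 hs).extremePoints_eq fun i => balanced_zero _
    simpa using this
  rw [← hs', hp.extremePoints_eq hb] at h1
  have h2 : AffineIndependent ℝ p := by
    refine AffineIndependent.of_set_of_injective ?_ (hp.injective hb)
    rw [h1]
    exact hs
  obtain ⟨t, ht⟩ := (hasDependency_zero_iff.2 h2 lam).1 ⟨hp.sum_eq_zero, hp.sum_smul_eq_zero⟩
  obtain ⟨i, hi⟩ := hlam
  apply hi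
  rw [ht]
  simp

theorem isPolytopeOfDim_convexHull_range [Nonempty ι] (p : ι → E) {d : ℕ}
    (h : Module.finrank ℝ (vectorSpan ℝ (convexHull ℝ (range p))) = d) :
    IsPolytopeOfDim (convexHull ℝ (range p)) d := by
  classical
  refine ⟨⟨Finset.univ.image p, by simp⟩, ?_, h⟩
  rw [convexHull_nonempty_iff]
  exact range_nonempty p

end Gale

/-! ### Signs attached to the three colors -/

section Signs

variable {ι : Type*} {c : ι → Fin 3}

theorem signs_pos_iff (i : Fin 3) : 0 < (![0, 1, -1] : Fin 3 → ℝ) i ↔ i = 1 := by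
  fin_cases i <;> simp

theorem signs_neg_iff (i : Fin 3) : (![0, 1, -1] : Fin 3 → ℝ) i < 0 ↔ i = 2 := by
  fin_cases i <;> simp

theorem signs_eq_zero_iff (i : Fin 3) : (![0, 1, -1] : Fin 3 → ℝ) i = 0 ↔ i = 0 := by
  fin_cases i <;> simp

theorem balanced_signs_iff (c : ι → Fin 3) (J : Set ι) :
    Balanced (fun i => (![0, 1, -1] : Fin 3 → ℝ) (c i)) J ↔
      ((∃ i, i ∉ J ∧ c i = 1) ↔ ∃ i, i ∉ J ∧ c i = 2) := by
  simp only [Balanced, signs_pos_iff, signs_neg_iff]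

/-- Both signs survive the removal of one index, so every point is a vertex. -/
theorem balanced_signs_singleton (h₁ : 1 < {i | c i = 1}.ncard) (h₂ : 1 < {i | c i = 2}.ncard)
    (i : ι) : Balanced (fun i => (![0, 1, -1] : Fin 3 → ℝ) (c i)) {i} := by
  rw [balanced_signs_iff]
  obtain ⟨j, hj, hji⟩ := exists_ne_of_one_lt_ncard h₁ i
  obtain ⟨k, hk, hki⟩ := exists_ne_of_one_lt_ncard h₂ i
  exact iff_of_true ⟨j, hji, hj⟩ ⟨k, hki, hk⟩

end Signs

end ThreeColor

/-! ### The structure of the hull of the incidence vectors -/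

theorem proposition2 {D : ℕ} (P : Set (EuclideanSpace ℝ (Fin D))) (n : ℕ)
    (hP : IsSimpleThreePolytope P)
    (hn : (Set.extremePoints ℝ P).ncard = 2 * n)
    (c : Facet P → Fin 3) (hc : IsThreeColoring P c)
    (m₁ m₂ m₃ : ℕ)
    (hm₁ : numColor P c 0 = m₁) (hm₂ : numColor P c 1 = m₂) (hm₃ : numColor P c 2 = m₃)
    (h₃₂ : m₃ = m₂) (h₂₁ : m₁ < m₂) (h₁ : 2 ≤ m₁) :
    -- the vertices of the convex hull are the incidence vectors, one for each facet
    (Function.Injective (incVec P) ∧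
      Set.extremePoints ℝ (tilde P) = Set.range (incVec P)) ∧
    -- the Gale diagram, unique up to the reflection of the line
    (∀ g : Facet P → EuclideanSpace ℝ (Fin 1),
      IsGaleDiagram (incVec P) g ↔
        ((∀ f, g f 0 = ![0, 1, -1] (c f)) ∨ (∀ f, g f 0 = ![0, -1, 1] (c f)))) ∧
    -- the proper faces
    (∀ J : Set (Vertex P → ℝ), J ⊂ Set.range (incVec P) →
      (IsProperFace (tilde P) (convexHull ℝ J) ↔
        ((¬ colorClass P c 1 ⊆ J ∧ ¬ colorClass P c 2 ⊆ J) ∨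
          colorClass P c 1 ∪ colorClass P c 2 ⊆ J))) ∧
    -- not simplicial
    ¬ IsSimplicial (tilde P) ∧
    -- an `n`-polytope that is an `m₁`-fold pyramid over a cyclic polytope
    (IsPolytopeOfDim (tilde P) n ∧
      ∃ K : Set (Vertex P → ℝ),
        IsFoldPyramid K m₁ (tilde P) ∧
        IsPolytopeOfDim K (2 * m₂ - 2) ∧
        (Set.extremePoints ℝ K).ncard = 2 * m₂ ∧
        IsTPolytope (2 * m₂ - 2) (m₂ - 1) K ∧
        ∀ t : Fin (2 * m₂) → ℝ, StrictMono t → CombEquiv K (cyclicPolytope (2 * m₂ - 2) t)) := by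
  classical
  subst hm₁ hm₂ hm₃
  have : Finite (Facet P) := hP.1.finite_facets
  have : Finite (Vertex P) := hP.1.finite_extremePoints
  have := Fintype.ofFinite (Facet P)
  have := Fintype.ofFinite (Vertex P)
  set lam : Facet P → ℝ := fun f => (![0, 1, -1] : Fin 3 → ℝ) (c f) with hlam
  have hp : HasDependency (incVec P) lam := hasDependency_incVec hP hc h₃₂ h₂₁
  have hn₁ : 1 < {f | c f = 1}.ncard := by unfold numColor at *; omega
  have hn₂ : 1 < {f | c f = 2}.ncard := by unfold numColor at *; omega
  have hsingle : ∀ f, Balanced lam {f} := balanced_signs_singleton hn₁ hn₂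
  have hinj := hp.injective hsingle
  have hext := hp.extremePoints_eq hsingle
  obtain ⟨f₁, hf₁⟩ : ∃ f, c f = 1 :=
    Set.nonempty_of_ncard_ne_zero (s := {f | c f = 1}) (by omega)
  obtain ⟨f₀, hf₀⟩ : ∃ f, c f = 0 :=
    Set.nonempty_of_ncard_ne_zero (s := {f | c f = 0}) (by unfold numColor at *; omega)
  have hne : ∃ f, lam f ≠ 0 := ⟨f₁, by simp [hlam, hf₁]⟩
  have hempty : Nonempty (Facet P) := ⟨f₁⟩
  -- the subfamily of the colors `1` and `2`
  let T : Set (Facet P) := {f | c f ≠ 0}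
  let q : T → Vertex P → ℝ := fun f => incVec P f
  let lam' : T → ℝ := fun f => (![0, 1, -1] : Fin 3 → ℝ) (c f)
  have hq : HasDependency q lam' := hp.subtype T fun f hf => by
    simp only [hlam, signs_eq_zero_iff]
    by_contra h
    exact hf h
  have hlam' : ∀ f, lam' f ≠ 0 := fun f h => f.2 ((signs_eq_zero_iff _).1 h)
  have hpre : ∀ i : Fin 3, i ≠ 0 → {f : T | c f = i}.ncard = numColor P c i := by
    intro i hi
    refine Set.ncard_preimage_of_injective_subset_range (f := ((↑) : T → Facet P))
      (s := {f | c f = i}) Subtype.val_injective ?_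
    rw [Subtype.range_coe]
    rintro f rfl
    exact hi
  have hsingle' : ∀ f, Balanced lam' {f} :=
    balanced_signs_singleton (c := fun f : T => c f) (by rw [hpre 1 (by decide)]; exact hn₁)
      (by rw [hpre 2 (by decide)]; exact hn₂)
  have hpos' : {f | 0 < lam' f}.ncard = numColor P c 1 := by
    rw [← hpre 1 (by decide)]
    simp only [lam', signs_pos_iff]
  have hcard' : Fintype.card T = 2 * numColor P c 1 := by
    have h1 : {f : T | c f = 1}ᶜ = {f : T | c f = 2} := by
      ext f
      have hf : c f ≠ 0 := f.2
      simp only [Set.mem_compl_iff, Set.mem_ofPred_eq]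
      revert hf
      generalize c f = i
      revert i
      decide
    have h2 := Set.ncard_add_ncard_compl {f : T | c f = 1}
    rw [h1, hpre 1 (by decide), hpre 2 (by decide), Nat.card_eq_fintype_card] at h2
    omega
  let f₁' : T := ⟨f₁, fun h => by rw [hf₁] at h; exact absurd h (by decide)⟩
  have hlam₁ : lam' f₁' = 1 := by simp [lam', f₁', hf₁]
  have hempty' : Nonempty T := ⟨f₁'⟩
  have hqrange : Set.range q = incVec P '' T := (Set.image_eq_range _ _).symm
  have hcompl : ∀ (i : Fin 3) (J : Set (Facet P)),
      ¬ colorClass P c i ⊆ incVec P '' J ↔ ∃ f, f ∉ J ∧ c f = i := by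
    intro i J
    rw [colorClass, Set.image_subset_image_iff hinj, Set.not_subset]
    exact exists_congr fun f => and_comm
  refine ⟨⟨hinj, hext⟩, fun g => ?_, fun J hJ => ?_, fun hsimp => ?_, ?_, ?_⟩
  · rw [hp.isGaleDiagram_iff hne]
    refine or_congr (forall_congr' fun f => ?_) (forall_congr' fun f => ?_)
    · have : |lam f|⁻¹ * lam f = (![0, 1, -1] : Fin 3 → ℝ) (c f) := by
        simp only [hlam]
        generalize c f = i
        fin_cases i <;> simp
      rw [this]
    · have : -(|lam f|⁻¹ * lam f) = (![0, -1, 1] : Fin 3 → ℝ) (c f) := by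
        simp only [hlam]
        generalize c f = i
        fin_cases i <;> simp
      rw [this]
  · obtain ⟨J, rfl⟩ := Set.subset_range_iff_exists_image_eq.1 hJ.subset
    have hJ' : J ≠ Set.univ := by
      rintro rfl
      rw [Set.image_univ] at hJ
      exact hJ.ne rfl
    rw [tilde, hp.isProperFace_iff hsingle, and_iff_left hJ', balanced_signs_iff,
      Set.union_subset_iff, ← hcompl 1, ← hcompl 2]
    tauto
  -- The offending proper face is `K`: its index set contains all nonzero entries of `lam` but
  -- misses color `0`.
  · refine hq.not_isSimplex hsingle' ⟨f₁', hlam' _⟩ (hsimp _ ?_)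
    rw [tilde, hqrange, hp.isProperFace_iff hsingle, balanced_signs_iff]
    refine ⟨iff_of_false ?_ ?_, fun h => ?_⟩
    · rintro ⟨f, hf, hf'⟩
      exact hf (fun h => by rw [hf'] at h; exact absurd h (by decide))
    · rintro ⟨f, hf, hf'⟩
      exact hf (fun h => by rw [hf'] at h; exact absurd h (by decide))
    · have : f₀ ∈ T := h ▸ Set.mem_univ f₀
      exact this hf₀
  · refine isPolytopeOfDim_convexHull_range _ ?_
    have h1 := hp.finrank_vectorSpan hne
    -- With `2 * n` vertices there are `n + 2` facets, and the dimension is two less than their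
    -- number.
    have h2 : 2 * Fintype.card (Facet P) = Fintype.card (Vertex P) + 4 := by
      obtain ⟨V⟩ := hc.nonempty_vertexFigures hP
      have : Nonempty (Vertex P) :=
        (hP.1.isCompact.extremePoints_nonempty hP.1.2.1).to_subtype
      refine V.two_mul_card_facet fun f => ?_
      obtain ⟨v, hv, hvf⟩ := hP.1.exists_vertex_mem f.2
      exact ⟨⟨v, hv⟩, hvf⟩
    rw [← Nat.card_eq_fintype_card (α := Vertex P), Nat.card_coe_set_eq, hn] at h2
    omega
  · refine ⟨convexHull ℝ (Set.range q), ?_, isPolytopeOfDim_convexHull_range _ ?_, ?_, ?_, ?_⟩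
    · have h1 := hp.isFoldPyramid T (Finset.univ.filter fun f => c f = 0)
        (fun f hf => by
          simp only [hlam, signs_eq_zero_iff]
          simpa using hf)
        (fun f hf h => h (by simpa using hf))
      have h2 : T ∪ ((Finset.univ.filter fun f => c f = 0 : Finset (Facet P)) : Set (Facet P)) =
          Set.univ := by
        ext f
        simp [T, or_comm, em]
      have h3 : (Finset.univ.filter fun f => c f = 0).card = numColor P c 0 := by
        rw [← Set.ncard_coe_finset, numColor]
        simp
      rw [h2, Set.image_univ, ← hqrange, h3] at h1
      exact h1
    · have := hq.finrank_vectorSpan ⟨f₁', hlam' _⟩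
      omega
    · rw [hq.extremePoints_eq hsingle', ← Set.image_univ,
        Set.ncard_image_of_injective _ (hq.injective hsingle'), Set.ncard_univ,
        Nat.card_eq_fintype_card, hcard']
    -- The point split off from the simplex has color `1`; it is beyond the facets opposite the
    -- other points of that color.
    · have h1 : {f | f ≠ f₁' ∧ 0 < lam' f / lam' f₁'} = {f | 0 < lam' f} \ {f₁'} := by
        ext f
        simp [hlam₁, and_comm]
      have h2 : {f | f ≠ f₁' ∧ 0 < lam' f / lam' f₁'}.ncard = numColor P c 1 - 1 := by
        rw [h1, Set.ncard_sdiff_singleton_of_mem (by simp [hlam₁]), hpos']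
      have h3 := hq.isTPolytope hlam' f₁' (by omega)
        (Set.nonempty_of_ncard_ne_zero (s := {f | f ≠ f₁' ∧ 0 < lam' f / lam' f₁'}) (by omega))
      rwa [h2, hcard'] at h3
    · intro t ht
      exact hq.combEquiv_cyclicPolytope hlam' (by omega) hcard' hpos' t ht
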